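/- Let $D\ge 3$, let $J\subseteq(0,\infty)$ be open, let $f,g:J\to(0,\infty)$ be continuously differentiable, and let $s(\chi)$ be one of $\sin\chi$ (spherical), $\chi$ (planar), $\sinh\chi$ (hyperbolic). Let $M$ be a smooth $D$-dimensional manifold with a metric and a function $r:M\to J$ such that every point of $M$ has coordinates $(t,r,\chi,\theta_1,\dots,\theta_{D-3})$ around it, whose second coordinate is the function $r$, in which the metric is $$ds^2=-f(r)\,dt^2+g(r)\,dr^2+r^2\bigl(d\chi^2+s(\chi)^2\,d\Omega_{D-3}^2\bigr),\qquad d\Omega_{D-3}^2=d\theta_1^2+\sin^2\theta_1\,d\theta_2^2+\dots+\sin^2\theta_1\cdots\sin^2\theta_{D-4}\,d\theta_{D-3}^2$$ (no $d\Omega^2$ term if $D=3$), with $0<\chi<\pi$ in the spherical case, $\chi>0$ in the other two, and $0<\theta_i<\pi$ for $i\le D-4$. Let $\rho$ be a value of $r$ and let $S_\rho=\{p\in M: r(p)=\rho\}$, a timelike hypersurface. Call $S_\rho$ a photon surface if it is a nowhere spacelike hypersurface and for every $p\in S_\rho$ and every nonzero null vector $k\in T_pS_\rho$ there are $\varepsilon>0$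 and an affinely parametrised null geodesic $\gamma:(-\varepsilon,\varepsilon)\to M$ with $\gamma(0)=p$, $\dot\gamma(0)=k$ and $\gamma((-\varepsilon,\varepsilon))\subset S_\rho$. Call $S_\rho$ totally umbilic if the trace-free part $\sigma_{ab}=\chi_{ab}-\frac{1}{D-1}\Theta h_{ab}$ of its second fundamental form vanishes at every point of $S_\rho$; here $n_a$ is the unit normal, $h_{ab}=g_{ab}-n_an_b$ is the induced metric, $\chi_{ab}=h_a{}^c\nabla_c n_b$ is the second fundamental form and $\Theta=h^{ab}\chi_{ab}$ is its trace. Then, in each of the spherical, planar and hyperbolic cases, $S_\rho$ is a photon surface if and only if $$\frac{d}{dr}\Bigl(\frac{f(r)}{r^{2}}\Bigr)\Big|_{r=\rho}=0,$$ and $S_\rho$ is totally umbilic if and only if the same condition holds. -/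

import Mathlib

open scoped Manifold ContDiff

noncomputable section

namespace PhotonSurface

/-- The coordinate space of a `D`-dimensional chart. -/
abbrev Coord (D : ℕ) : Type := Fin D → ℝ

/-! ### Tensor calculus in one coordinate system

`G x` is the matrix of metric components at the coordinate point `x`; `F` is a function whose
level sets are hypersurfaces. -/

section Coordinates

variable {D : ℕ}

/-- The partial derivative `∂_a u` at `x`. -/
def pd (a : Fin D) (u : Coord D → ℝ) (x : Coord D) : ℝ :=
  fderiv ℝ u x (Pi.single a 1)

/-- The Christoffel symbol `Γ^c_{ab}` of the metric `G` at `x`. -/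
def christoffel (G : Coord D → Matrix (Fin D) (Fin D) ℝ) (x : Coord D) (c a b : Fin D) : ℝ :=
  1 / 2 * ∑ d, (G x)⁻¹ c d *
    (pd a (fun y => G y d b) x + pd b (fun y => G y d a) x - pd d (fun y => G y a b) x)

/-- The unit normal covector `n_a = ∂_a F / √(g^{bc} ∂_b F ∂_c F)` of the level sets of `F`
(where these are timelike, so that the normal is spacelike). -/
def normalCovector (G : Coord D → Matrix (Fin D) (Fin D) ℝ) (F : Coord D → ℝ) (x : Coord D)
    (a : Fin D) : ℝ :=
  pd a F x / √(∑ b, ∑ c, (G x)⁻¹ b c * pd b F x * pd c F x)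

/-- The unit normal vector `n^a = g^{ab} n_b`. -/
def normalVector (G : Coord D → Matrix (Fin D) (Fin D) ℝ) (F : Coord D → ℝ) (x : Coord D)
    (a : Fin D) : ℝ :=
  ∑ b, (G x)⁻¹ a b * normalCovector G F x b

/-- The induced metric `h_{ab} = g_{ab} - n_a n_b`. -/
def inducedMetric (G : Coord D → Matrix (Fin D) (Fin D) ℝ) (F : Coord D → ℝ) (x : Coord D)
    (a b : Fin D) : ℝ :=
  G x a b - normalCovector G F x a * normalCovector G F x b

/-- The covariant derivative `∇_c n_b = ∂_c n_b - Γ^d_{cb} n_d`. -/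
def covDerivNormal (G : Coord D → Matrix (Fin D) (Fin D) ℝ) (F : Coord D → ℝ) (x : Coord D)
    (c b : Fin D) : ℝ :=
  pd c (fun y => normalCovector G F y b) x
    - ∑ d, christoffel G x d c b * normalCovector G F x d

/-- The second fundamental form `χ_{ab} = h^c_a ∇_c n_b`, where `h^c_a = δ^c_a - n^c n_a`. -/
def secondFundamentalForm (G : Coord D → Matrix (Fin D) (Fin D) ℝ) (F : Coord D → ℝ)
    (x : Coord D) (a b : Fin D) : ℝ :=
  ∑ c, ((if c = a then 1 else 0) - normalVector G F x c * normalCovector G F x a)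
    * covDerivNormal G F x c b

/-- The trace `Θ = h^{ab} χ_{ab}`, where `h^{ab} = g^{ab} - n^a n^b`. -/
def meanTrace (G : Coord D → Matrix (Fin D) (Fin D) ℝ) (F : Coord D → ℝ) (x : Coord D) : ℝ :=
  ∑ a, ∑ b, ((G x)⁻¹ a b - normalVector G F x a * normalVector G F x b)
    * secondFundamentalForm G F x a b

/-- The trace-free part `σ_{ab} = χ_{ab} - Θ h_{ab} / (D - 1)` of the second fundamental form. -/
def traceFreePart (G : Coord D → Matrix (Fin D) (Fin D) ℝ) (F : Coord D → ℝ) (x : Coord D)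
    (a b : Fin D) : ℝ :=
  secondFundamentalForm G F x a b - 1 / ((D : ℝ) - 1) * meanTrace G F x * inducedMetric G F x a b

end Coordinates

/-! ### Manifolds with a metric -/

section Manifold

variable {D : ℕ} {M : Type*} [TopologicalSpace M] [ChartedSpace (Coord D) M]

variable (D M) in
/-- A field of bilinear forms on the tangent spaces of `M`. -/
abbrev BilinField : Type _ :=
  ∀ p : M, TangentSpace 𝓘(ℝ, Coord D) p →L[ℝ] TangentSpace 𝓘(ℝ, Coord D) p →L[ℝ] ℝ

variable (D M) in
/-- The smooth charts of `M`, that is, those of the maximal smooth atlas. -/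
abbrev smoothCharts : Set (OpenPartialHomeomorph M (Coord D)) :=
  IsManifold.maximalAtlas 𝓘(ℝ, Coord D) ∞ M

/-- The components `g_{ab} = g(∂_a, ∂_b)` in the chart `e`, as functions of the coordinates. -/
def metricInChart (g : BilinField D M) (e : OpenPartialHomeomorph M (Coord D)) (x : Coord D) :
    Matrix (Fin D) (Fin D) ℝ :=
  Matrix.of fun a b =>
    g (e.symm x)
      (mfderiv 𝓘(ℝ, Coord D) 𝓘(ℝ, Coord D) e.symm x (Pi.single a 1 : Coord D))
      (mfderiv 𝓘(ℝ, Coord D) 𝓘(ℝ, Coord D) e.symm x (Pi.single b 1 : Coord D))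

/-- The velocity of the curve `γ` at time `τ`. -/
def velocity (D : ℕ) {M : Type*} [TopologicalSpace M] [ChartedSpace (Coord D) M]
    (γ : ℝ → M) (τ : ℝ) : TangentSpace 𝓘(ℝ, Coord D) (γ τ) :=
  mfderiv 𝓘(ℝ, ℝ) 𝓘(ℝ, Coord D) γ τ (1 : ℝ)

/-- `γ` is an affinely parametrised null geodesic on the open set of times `s`: it is `C²`,
satisfies `ẍ^c + Γ^c_{ab} ẋ^a ẋ^b = 0` in every smooth chart, and has null velocity. -/
structure IsNullGeodesicOn (g : BilinField D M) (γ : ℝ → M) (s : Set ℝ) : Prop where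
  contMDiffOn : ContMDiffOn 𝓘(ℝ, ℝ) 𝓘(ℝ, Coord D) 2 γ s
  geodesic_equation : ∀ e ∈ smoothCharts D M, ∀ τ ∈ s, γ τ ∈ e.source → ∀ c : Fin D,
    deriv (deriv fun t => e (γ t) c) τ
      + ∑ a, ∑ b, christoffel (metricInChart g e) (e (γ τ)) c a b
          * deriv (fun t => e (γ t) a) τ * deriv (fun t => e (γ t) b) τ = 0
  null : ∀ τ ∈ s, g (γ τ) (velocity D γ τ) (velocity D γ τ) = 0

/-- `v` is tangent at `p` to the level set of `F` through `p`. -/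
def IsTangent (F : M → ℝ) (p : M) (v : TangentSpace 𝓘(ℝ, Coord D) p) : Prop :=
  mfderiv 𝓘(ℝ, Coord D) 𝓘(ℝ, ℝ) F p v = (0 : ℝ)

/-- The level set `S = {F = c}` is a photon surface of `(M, g)`: it is a (regular) hypersurface,
it is nowhere spacelike (the induced metric is nowhere positive definite), and for every `p ∈ S`
and every null vector `k` tangent to `S` at `p` there is a null geodesic
`γ : (-ε, ε) → M` with `γ(0) = p` and `γ'(0) = k` which lies in `S`. -/
structure IsPhotonSurface (g : BilinField D M) (F : M → ℝ) (c : ℝ) : Prop where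
  regular : ∀ p : M, F p = c →
    ContMDiffAt 𝓘(ℝ, Coord D) 𝓘(ℝ, ℝ) ∞ F p ∧
      ∃ v : TangentSpace 𝓘(ℝ, Coord D) p, ¬ IsTangent F p v
  nowhere_spacelike : ∀ p : M, F p = c →
    ∃ v : TangentSpace 𝓘(ℝ, Coord D) p, IsTangent F p v ∧ v ≠ 0 ∧ g p v v ≤ 0
  null_geodesics : ∀ p : M, F p = c → ∀ k : TangentSpace 𝓘(ℝ, Coord D) p,
    IsTangent F p k → k ≠ 0 → g p k k = 0 →
      ∃ ε > 0, ∃ γ : ℝ → M, IsNullGeodesicOn g γ (Set.Ioo (-ε) ε) ∧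
        (⟨γ 0, velocity D γ 0⟩ : TangentBundle 𝓘(ℝ, Coord D) M) = ⟨p, k⟩ ∧
        ∀ τ ∈ Set.Ioo (-ε) ε, F (γ τ) = c

/-- The timelike level set `S = {F = c}` is totally umbilic: the trace-free part of its second
fundamental form vanishes at every point of `S` (in every smooth chart). -/
def IsTotallyUmbilic (g : BilinField D M) (F : M → ℝ) (c : ℝ) : Prop :=
  ∀ p : M, F p = c → ∀ e ∈ smoothCharts D M, p ∈ e.source → ∀ a b : Fin D,
    traceFreePart (metricInChart g e) (F ∘ e.symm) (e p) a b = 0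

end Manifold

/-! ### The static metrics of spherical, planar and hyperbolic symmetry

The dimension is `D = n + 3`, and the coordinates `x 0, x 1, x 2, x 3, …, x (n + 2)` are
`t, r, χ, θ₁, …, θₙ`. -/

inductive SpatialSymmetry
  | spherical
  | planar
  | hyperbolic

/-- The function `s(χ)`. -/
def SpatialSymmetry.s : SpatialSymmetry → ℝ → ℝ
  | spherical, χ => Real.sin χ
  | planar, χ => χ
  | hyperbolic, χ => Real.sinh χ

/-- The range of the radial angle `χ`. -/
def SpatialSymmetry.chiRange : SpatialSymmetry → Set ℝ
  | spherical => Set.Ioo 0 Real.pi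
  | planar => Set.Ioi 0
  | hyperbolic => Set.Ioi 0

/-- The coordinate range: `r ∈ J`, `χ` in its range, `θ₁, …, θₙ₋₁ ∈ (0, π)`; the time `t` and the
last (azimuthal) angle `θₙ` are unrestricted. -/
def coordRange (n : ℕ) (κ : SpatialSymmetry) (J : Set ℝ) : Set (Coord (n + 3)) :=
  {x | x 1 ∈ J ∧ x 2 ∈ κ.chiRange ∧
    ∀ l : Fin (n + 3), 3 ≤ l.val → l.val < n + 2 → x l ∈ Set.Ioo 0 Real.pi}

/-- The coefficient of `(dx^a)²` in
`-f(r) dt² + g(r) dr² + r² (dχ² + s(χ)² (dθ₁² + sin² θ₁ dθ₂² + … ))`. -/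
def staticCoeff (n : ℕ) (κ : SpatialSymmetry) (f g : ℝ → ℝ) (x : Coord (n + 3))
    (a : Fin (n + 3)) : ℝ :=
  if a = 0 then -f (x 1)
  else if a = 1 then g (x 1)
  else if a = 2 then x 1 ^ 2
  else x 1 ^ 2 * (κ.s (x 2) ^ 2 *
    ∏ l : Fin (n + 3) with 3 ≤ l.val ∧ l < a, Real.sin (x l) ^ 2)

/-- `(M, G)` is a static spacetime with metric
`-f(r) dt² + g(r) dr² + r² (dχ² + s(χ)² dΩ²)` and radius function `R : M → J`: around every point
there are coordinates `(t, r, χ, θ₁, …, θₙ)` with `r = R` in which `G` has this form.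
(Points on the axis of one polar coordinate system are covered by another one.) -/
def IsStaticSpacetime {n : ℕ} {M : Type*} [TopologicalSpace M] [ChartedSpace (Coord (n + 3)) M]
    (κ : SpatialSymmetry) (J : Set ℝ) (f g : ℝ → ℝ) (G : BilinField (n + 3) M) (R : M → ℝ) :
    Prop :=
  ∀ p : M, ∃ e ∈ smoothCharts (n + 3) M, p ∈ e.source ∧
    (∀ q ∈ e.source, e q ∈ coordRange n κ J ∧ R q = e q 1) ∧
    ∀ x ∈ e.target, metricInChart G e x = Matrix.diagonal (staticCoeff n κ f g x)

end PhotonSurface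

end

open Filter Topology

noncomputable section

namespace PhotonSurface

/-! ### Partial derivatives, Jacobians and the transformation law of the Christoffel symbols. -/

section Coordinates

variable {D : ℕ}

/-! Since `(f/r²)' = (f/r²)(f'/f - 2/r)`, the condition says that `-f` and `r²` have the same
logarithmic derivative at `ρ`. Both equivalences are read off from this form in a static chart,
where the metric is diagonal with coefficients `q_a`, and `∂_r q_a = μ_a q_a` for `a ≠ r`, with `μ_t
= f'/f` and every other `μ_a = 2/r`.

Umbilicity: the second fundamental form of `r = ρ` is diagonal with principal curvatures `μ_a /
(2√g)`, so its trace-free part vanishes iff all `μ_a` agree (`traceFreePart_diagMetric`,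
`traceFreePart_static_eq_zero_iff`).

Photon surface: for a null vector `u` tangent to `r = ρ`, the radial geodesic acceleration is `(2/r
- f'/f) f (u^t)² / (2g)` (`diagAccel_staticCoeff_radial`). A null geodesic in the surface with `u^t
≠ 0` forces the condition. Conversely, `f` and `g` are only `C¹`, so the Christoffel symbols are
merely continuous and Picard-Lindelöf is not available for the metric itself. The coefficients are
therefore frozen at `r = ρ`. Geodesics of the frozen metric starting tangentially stay in the
surface and stay null, and under the condition they solve the original equation
(`exists_null_geodesic_static`).

The definitions quantify over all smooth charts. The transformation laws `geodesicOp_transform` and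
`traceFreePart_transform` reduce every chart to a static one; `IsStaticChart.isPullbackAt` makes
them applicable. -/

lemma fderiv_apply_eq_sum_pd (u : Coord D → ℝ) (x v : Coord D) :
    fderiv ℝ u x v = ∑ a, v a * pd a u x := by
  conv_lhs => rw [pi_eq_sum_univ' v]
  simp only [map_sum, map_smul, smul_eq_mul, pd]

lemma pd_congr {u v : Coord D → ℝ} {x : Coord D} (h : u =ᶠ[𝓝 x] v) (a : Fin D) :
    pd a u x = pd a v x := by
  simp only [pd, h.fderiv_eq]

lemma pd_const (a : Fin D) (c : ℝ) (x : Coord D) : pd a (fun _ => c) x = 0 := by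
  simp [pd]

lemma pd_mul {u v : Coord D → ℝ} {x : Coord D} (hu : DifferentiableAt ℝ u x)
    (hv : DifferentiableAt ℝ v x) (a : Fin D) :
    pd a (fun y => u y * v y) x = pd a u x * v x + u x * pd a v x := by
  simp only [pd, fderiv_fun_mul hu hv]
  simp
  ring

lemma pd_sum {ι : Type*} (s : Finset ι) {u : ι → Coord D → ℝ} {x : Coord D}
    (hu : ∀ i ∈ s, DifferentiableAt ℝ (u i) x) (a : Fin D) :
    pd a (fun y => ∑ i ∈ s, u i y) x = ∑ i ∈ s, pd a (u i) x := by
  simp only [pd, fderiv_fun_sum hu]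
  simp

lemma pd_coord (a b : Fin D) (x : Coord D) :
    pd a (fun y : Coord D => y b) x = if b = a then 1 else 0 := by
  have : HasFDerivAt (fun y : Coord D => y b) (ContinuousLinearMap.proj (R := ℝ) b) x :=
    (ContinuousLinearMap.proj (R := ℝ) (φ := fun _ : Fin D => ℝ) b).hasFDerivAt
  simp [pd, this.fderiv, Pi.single_apply]

/-- The Jacobian matrix `∂_a φ^i`. -/
def jac (φ : Coord D → Coord D) (y : Coord D) : Matrix (Fin D) (Fin D) ℝ :=
  Matrix.of fun i a => pd a (fun z => φ z i) y

lemma jac_apply (φ : Coord D → Coord D) (y : Coord D) (i a : Fin D) :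
    jac φ y i a = pd a (fun z => φ z i) y := rfl

lemma jac_eq_fderiv {φ : Coord D → Coord D} {y : Coord D} (h : DifferentiableAt ℝ φ y)
    (i a : Fin D) : jac φ y i a = fderiv ℝ φ y (Pi.single a 1) i := by
  rw [jac_apply, pd, fderiv_apply h]
  rfl

lemma fderiv_apply_eq_jac_mulVec {φ : Coord D → Coord D} {y : Coord D}
    (h : DifferentiableAt ℝ φ y) (v : Coord D) : fderiv ℝ φ y v = (jac φ y).mulVec v := by
  ext i
  have : fderiv ℝ φ y v i = fderiv ℝ (fun z => φ z i) y v := by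
    rw [fderiv_apply h]; rfl
  rw [this, fderiv_apply_eq_sum_pd]
  simp only [Matrix.mulVec, dotProduct, jac_apply, mul_comm]

lemma pd_comp {φ : Coord D → Coord D} {F : Coord D → ℝ} {y : Coord D}
    (hF : DifferentiableAt ℝ F (φ y)) (hφ : DifferentiableAt ℝ φ y) (b : Fin D) :
    pd b (fun z => F (φ z)) y = ∑ i, pd i F (φ y) * jac φ y i b := by
  have : fderiv ℝ (fun z => F (φ z)) y = (fderiv ℝ F (φ y)).comp (fderiv ℝ φ y) :=
    fderiv_comp y hF hφ
  rw [pd, this, ContinuousLinearMap.comp_apply, fderiv_apply_eq_sum_pd]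
  refine Finset.sum_congr rfl fun i _ => ?_
  rw [jac_eq_fderiv hφ, mul_comm]

lemma contDiffAt_pd {m n : WithTop ℕ∞} {u : Coord D → ℝ} {x : Coord D}
    (h : ContDiffAt ℝ n u x) (hmn : m + 1 ≤ n) (a : Fin D) : ContDiffAt ℝ m (pd a u) x :=
  (h.fderiv_right hmn).clm_apply contDiffAt_const

lemma differentiableAt_jac {φ : Coord D → Coord D} {y : Coord D} (h : ContDiffAt ℝ 2 φ y)
    (i a : Fin D) : DifferentiableAt ℝ (fun z => jac φ z i a) y :=
  (contDiffAt_pd (m := 1) (contDiffAt_pi.1 h i) (by norm_num) a).differentiableAt (by norm_num)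

lemma pd_pd_comm {u : Coord D → ℝ} {x : Coord D} (h : ContDiffAt ℝ 2 u x) (a b : Fin D) :
    pd a (pd b u) x = pd b (pd a u) x := by
  have hs : IsSymmSndFDerivAt ℝ u x := h.isSymmSndFDerivAt (by simp)
  have hd : DifferentiableAt ℝ (fderiv ℝ u) x :=
    (h.fderiv_right (m := 1) (by norm_num)).differentiableAt (by norm_num)
  have key : ∀ a b : Fin D, pd a (pd b u) x =
      fderiv ℝ (fderiv ℝ u) x (Pi.single a 1) (Pi.single b 1) := by
    intro a b
    change fderiv ℝ (fun z => fderiv ℝ u z (Pi.single b 1)) x _ = _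
    rw [fderiv_clm_apply hd (differentiableAt_const _)]
    simp
  rw [key, key, hs.eq]

lemma pd_jac_comm {φ : Coord D → Coord D} {y : Coord D} (h : ContDiffAt ℝ 2 φ y)
    (i a b : Fin D) : pd a (fun z => jac φ z i b) y = pd b (fun z => jac φ z i a) y :=
  pd_pd_comm (contDiffAt_pi.1 h i) a b

/-- Near `y`, the metric `G'` is the pullback of the metric `G` by the local diffeomorphism `φ`. -/
structure IsPullbackAt (φ : Coord D → Coord D) (G G' : Coord D → Matrix (Fin D) (Fin D) ℝ)
    (y : Coord D) : Prop where
  contDiffAt : ContDiffAt ℝ 2 φ y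
  eq : ∀ᶠ z in 𝓝 y, G' z = (jac φ z).transpose * G (φ z) * jac φ z
  jac_isUnit : ∀ᶠ z in 𝓝 y, IsUnit (jac φ z).det
  metric_isUnit : ∀ᶠ z in 𝓝 y, IsUnit (G (φ z)).det
  differentiableAt : ∀ i j, DifferentiableAt ℝ (fun x => G x i j) (φ y)
  symm : (G (φ y)).transpose = G (φ y)

/-- The inverse metric is contravariant. Only the Jacobian has to be invertible, because
`Matrix.mul_inv_rev` holds for singular matrices as well. -/
lemma inv_pullback {J G G' : Matrix (Fin D) (Fin D) ℝ} (h : G' = J.transpose * G * J)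
    (hJ : IsUnit J.det) : J * G'⁻¹ * J.transpose = G⁻¹ := by
  have hJt : IsUnit J.transpose.det := by rwa [Matrix.det_transpose]
  rw [h, Matrix.mul_inv_rev, Matrix.mul_inv_rev, ← mul_assoc, ← mul_assoc,
    Matrix.mul_nonsing_inv _ hJ, one_mul, mul_assoc, Matrix.nonsing_inv_mul _ hJt, mul_one]

/-- Twice the Christoffel symbol of the first kind. -/
def christoffelLower (G : Coord D → Matrix (Fin D) (Fin D) ℝ) (x : Coord D) (d a b : Fin D) : ℝ :=
  pd a (fun y => G y d b) x + pd b (fun y => G y d a) x - pd d (fun y => G y a b) x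

lemma christoffel_eq (G : Coord D → Matrix (Fin D) (Fin D) ℝ) (x : Coord D) (c a b : Fin D) :
    christoffel G x c a b = 1 / 2 * ∑ d, (G x)⁻¹ c d * christoffelLower G x d a b := rfl

namespace IsPullbackAt

variable {φ : Coord D → Coord D} {G G' : Coord D → Matrix (Fin D) (Fin D) ℝ} {y : Coord D}

lemma pd_metric (h : IsPullbackAt φ G G' y) (d a b : Fin D) :
    pd d (fun z => G' z a b) y =
      ∑ i, ∑ j, ∑ k, jac φ y i a * jac φ y j b * jac φ y k d * pd k (fun x => G x i j) (φ y)
      + ∑ i, ∑ j, G (φ y) i j * pd d (fun z => jac φ z i a) y * jac φ y j b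
      + ∑ i, ∑ j, G (φ y) i j * jac φ y i a * pd d (fun z => jac φ z j b) y := by
  have hφ : DifferentiableAt ℝ φ y := h.contDiffAt.differentiableAt (by norm_num)
  have hJ := differentiableAt_jac h.contDiffAt
  have hG : ∀ i j, DifferentiableAt ℝ (fun z => G (φ z) i j) y := fun i j =>
    (h.differentiableAt i j).comp y hφ
  have e1 : (fun z => G' z a b) =ᶠ[𝓝 y]
      fun z => ∑ i, ∑ j, jac φ z i a * G (φ z) i j * jac φ z j b := by
    filter_upwards [h.eq] with z hz
    rw [hz]
    simp only [Matrix.mul_apply, Matrix.transpose_apply, Finset.sum_mul]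
    exact Finset.sum_comm
  rw [pd_congr e1, pd_sum _ fun i _ => DifferentiableAt.fun_sum fun j _ =>
    ((hJ i a).fun_mul (hG i j)).fun_mul (hJ j b)]
  rw [← Finset.sum_add_distrib, ← Finset.sum_add_distrib]
  refine Finset.sum_congr rfl fun i _ => ?_
  rw [pd_sum _ fun j _ => ((hJ i a).fun_mul (hG i j)).fun_mul (hJ j b), ← Finset.sum_add_distrib,
    ← Finset.sum_add_distrib]
  refine Finset.sum_congr rfl fun j _ => ?_
  rw [pd_mul ((hJ i a).fun_mul (hG i j)) (hJ j b), pd_mul (hJ i a) (hG i j),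
    pd_comp (h.differentiableAt i j) hφ]
  have : ∑ k, jac φ y i a * jac φ y j b * jac φ y k d * pd k (fun x => G x i j) (φ y) =
      jac φ y i a * jac φ y j b * ∑ k, pd k (fun x => G x i j) (φ y) * jac φ y k d := by
    rw [Finset.mul_sum]
    exact Finset.sum_congr rfl fun k _ => by ring
  rw [this]
  ring

/-- Of the six terms with a second derivative of `φ`, four cancel in pairs and the other two
coincide, by symmetry of `G` and of second derivatives. This is the source of the factor 2. -/
lemma christoffelLower_eq (h : IsPullbackAt φ G G' y) (d a b : Fin D) :
    christoffelLower G' y d a b = ∑ i, jac φ y i d *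
      (∑ j, ∑ k, christoffelLower G (φ y) i j k * jac φ y j a * jac φ y k b
        + 2 * ∑ j, G (φ y) i j * pd a (fun z => jac φ z j b) y) := by
  have hG : ∀ i j, G (φ y) i j = G (φ y) j i := fun i j => congrFun (congrFun h.symm j) i
  have c1 := pd_jac_comm h.contDiffAt
  rw [christoffelLower, h.pd_metric, h.pd_metric, h.pd_metric]
  have t1 : ∑ i, ∑ j, ∑ k, jac φ y i d * jac φ y j b * jac φ y k a * pd k (fun x => G x i j) (φ y)
      = ∑ i, ∑ j, ∑ k, jac φ y i d * jac φ y j a * jac φ y k b * pd j (fun x => G x i k) (φ y) := by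
    refine Finset.sum_congr rfl fun i _ => ?_
    rw [Finset.sum_comm]
    exact Finset.sum_congr rfl fun j _ => Finset.sum_congr rfl fun k _ => by ring
  have t3 : ∑ i, ∑ j, ∑ k, jac φ y i a * jac φ y j b * jac φ y k d * pd k (fun x => G x i j) (φ y)
      = ∑ i, ∑ j, ∑ k, jac φ y i d * jac φ y j a * jac φ y k b * pd i (fun x => G x j k) (φ y) := by
    conv_rhs => rw [Finset.sum_comm]
    refine Finset.sum_congr rfl fun i _ => ?_
    rw [Finset.sum_comm]
    conv_lhs => rw [Finset.sum_comm]
    rw [Finset.sum_comm]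
    exact Finset.sum_congr rfl fun j _ => Finset.sum_congr rfl fun k _ => by ring
  have t4 : ∑ i, ∑ j, G (φ y) i j * jac φ y i a * pd d (fun z => jac φ z j b) y =
      ∑ i, ∑ j, G (φ y) i j * pd b (fun z => jac φ z i d) y * jac φ y j a := by
    rw [Finset.sum_comm]
    exact Finset.sum_congr rfl fun j _ => Finset.sum_congr rfl fun k _ => by
      rw [hG k j, c1 j d b]; ring
  have t5 : ∑ i, ∑ j, G (φ y) i j * pd d (fun z => jac φ z i a) y * jac φ y j b =
      ∑ i, ∑ j, G (φ y) i j * pd a (fun z => jac φ z i d) y * jac φ y j b :=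
    Finset.sum_congr rfl fun j _ => Finset.sum_congr rfl fun k _ => by rw [c1 j d a]
  have t6 : ∑ i, ∑ j, G (φ y) i j * jac φ y i d * pd b (fun z => jac φ z j a) y =
      ∑ i, ∑ j, G (φ y) i j * jac φ y i d * pd a (fun z => jac φ z j b) y :=
    Finset.sum_congr rfl fun j _ => Finset.sum_congr rfl fun k _ => by rw [c1 k b a]
  rw [t1, t3, t4, t5, t6]
  have r : ∀ i, jac φ y i d *
      (∑ j, ∑ k, christoffelLower G (φ y) i j k * jac φ y j a * jac φ y k b
        + 2 * ∑ j, G (φ y) i j * pd a (fun z => jac φ z j b) y) =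
      ∑ j, ∑ k, jac φ y i d * jac φ y j a * jac φ y k b * pd j (fun x => G x i k) (φ y)
      + ∑ j, ∑ k, jac φ y i d * jac φ y j a * jac φ y k b * pd k (fun x => G x i j) (φ y)
      - ∑ j, ∑ k, jac φ y i d * jac φ y j a * jac φ y k b * pd i (fun x => G x j k) (φ y)
      + 2 * ∑ j, G (φ y) i j * jac φ y i d * pd a (fun z => jac φ z j b) y := by
    intro i
    simp only [mul_add, Finset.mul_sum, ← Finset.sum_add_distrib, ← Finset.sum_sub_distrib,
      christoffelLower]
    refine Finset.sum_congr rfl fun j _ => congrArg₂ _ ?_ (by ring)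
    exact Finset.sum_congr rfl fun k _ => by ring
  rw [Finset.sum_congr rfl fun i _ => r i]
  simp only [Finset.sum_add_distrib, Finset.sum_sub_distrib, ← Finset.mul_sum]
  ring

/-- The transformation law of the Christoffel symbols. -/
lemma christoffel_transform (h : IsPullbackAt φ G G' y) (l a b : Fin D) :
    ∑ c, jac φ y l c * christoffel G' y c a b =
      ∑ j, ∑ k, christoffel G (φ y) l j k * jac φ y j a * jac φ y k b
        + pd a (fun z => jac φ z l b) y := by
  set V : Fin D → ℝ := fun i =>
    ∑ j, ∑ k, christoffelLower G (φ y) i j k * jac φ y j a * jac φ y k b with hV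
  set W : Fin D → ℝ := fun j => pd a (fun z => jac φ z j b) y with hW
  have e1 : (fun d => christoffelLower G' y d a b) =
      (jac φ y).transpose.mulVec (V + (2 : ℝ) • (G (φ y)).mulVec W) := by
    ext d
    rw [h.christoffelLower_eq]
    simp [Matrix.mulVec, dotProduct, hV, hW]
  have e2 : (fun c => christoffel G' y c a b) =
      (1 / 2 : ℝ) • ((G' y)⁻¹.mulVec fun d => christoffelLower G' y d a b) := by
    ext c
    simp [christoffel_eq, Matrix.mulVec, dotProduct]
  -- By `inv_pullback` the product `J G'⁻¹ Jᵀ` becomes `G⁻¹`, which cancels `G` in front of `W`.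
  have e3 : (jac φ y).mulVec (fun c => christoffel G' y c a b) =
      (1 / 2 : ℝ) • (G (φ y))⁻¹.mulVec V + W := by
    rw [e2, e1, Matrix.mulVec_smul, Matrix.mulVec_mulVec, Matrix.mulVec_mulVec,
      inv_pullback h.eq.self_of_nhds h.jac_isUnit.self_of_nhds, Matrix.mulVec_add,
      Matrix.mulVec_smul, Matrix.mulVec_mulVec,
      Matrix.nonsing_inv_mul _ h.metric_isUnit.self_of_nhds, Matrix.one_mulVec, smul_add, smul_smul]
    norm_num
  have e4 := congrFun e3 l
  simp only [Matrix.mulVec, dotProduct, Pi.add_apply, Pi.smul_apply, smul_eq_mul] at e4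
  rw [e4]
  congr 1
  simp only [hV, christoffel_eq, Finset.mul_sum, Finset.sum_mul]
  rw [Finset.sum_comm]
  refine Finset.sum_congr rfl fun j _ => ?_
  rw [Finset.sum_comm]
  exact Finset.sum_congr rfl fun k _ => Finset.sum_congr rfl fun i _ => by ring

end IsPullbackAt

end Coordinates

/-! ### Covariance of the geodesic equation and of the second fundamental form. -/

section Coordinates

variable {D : ℕ}

lemma deriv_comp_curve {F : Coord D → ℝ} {y : ℝ → Coord D} {t : ℝ}
    (hF : DifferentiableAt ℝ F (y t)) (hy : DifferentiableAt ℝ y t) :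
    deriv (fun s => F (y s)) t = ∑ a, pd a F (y t) * deriv (fun s => y s a) t := by
  have h : HasDerivAt (fun s => F (y s)) (fderiv ℝ F (y t) (deriv y t)) t :=
    hF.hasFDerivAt.comp_hasDerivAt t hy.hasDerivAt
  rw [h.deriv, fderiv_apply_eq_sum_pd]
  refine Finset.sum_congr rfl fun a _ => ?_
  rw [deriv_pi (differentiableAt_pi.1 hy), mul_comm]

/-- The left-hand side `ẍ^c + Γ^c_{ab} ẋ^a ẋ^b` of the geodesic equation. -/
def geodesicOp (G : Coord D → Matrix (Fin D) (Fin D) ℝ) (x : ℝ → Coord D) (τ : ℝ)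
    (c : Fin D) : ℝ :=
  deriv (deriv fun t => x t c) τ
    + ∑ a, ∑ b, christoffel G (x τ) c a b * deriv (fun t => x t a) τ * deriv (fun t => x t b) τ

lemma differentiableAt_deriv_coord {y : ℝ → Coord D} {τ : ℝ} (hy : ContDiffAt ℝ 2 y τ)
    (a : Fin D) : DifferentiableAt ℝ (deriv fun t => y t a) τ :=
  ((contDiffAt_pi.1 hy a).derivWithin (m := 1) (by norm_num)).differentiableAt (by norm_num)

namespace IsPullbackAt

variable {φ : Coord D → Coord D} {G G' : Coord D → Matrix (Fin D) (Fin D) ℝ}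

/-- Differentiating `x = φ ∘ y` twice gives a term quadratic in the velocity with the second
derivatives of `φ`; it is exactly the inhomogeneous term of `christoffel_transform`. Hence the
acceleration is a vector. -/
lemma geodesicOp_transform {x y : ℝ → Coord D} {τ : ℝ} (h : IsPullbackAt φ G G' (y τ))
    (hy : ContDiffAt ℝ 2 y τ) (hx : x =ᶠ[𝓝 τ] fun t => φ (y t)) :
    geodesicOp G x τ = (jac φ (y τ)).mulVec (geodesicOp G' y τ) := by
  have hyd := differentiableAt_deriv_coord hy
  -- The first-order chain rule is needed on a neighbourhood, since it is differentiated once more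
  -- in `d2`.
  have d1 : ∀ c, deriv (fun t => x t c) =ᶠ[𝓝 τ]
      fun t => ∑ a, jac φ (y t) c a * deriv (fun s => y s a) t := by
    intro c
    have n1 : ∀ᶠ t in 𝓝 τ, ContDiffAt ℝ 2 φ (y t) :=
      hy.continuousAt.eventually (h.contDiffAt.eventually (by simp))
    filter_upwards [hx.eventually_nhds, n1, hy.eventually (by simp)] with t ht1 ht2 ht3
    have : (fun s => x s c) =ᶠ[𝓝 t] fun s => (fun z => φ z c) (y s) := by
      filter_upwards [ht1] with s hs
      rw [hs]
    rw [this.deriv_eq, deriv_comp_curve (F := fun z => φ z c)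
      (differentiableAt_pi.1 (ht2.differentiableAt (by norm_num)) c)
      (ht3.differentiableAt (by norm_num))]
    rfl
  have hJ := differentiableAt_jac h.contDiffAt
  have hyτ : DifferentiableAt ℝ y τ := hy.differentiableAt (by norm_num)
  have hJy : ∀ i a, DifferentiableAt ℝ (fun t => jac φ (y t) i a) τ := fun i a =>
    (hJ i a).comp τ hyτ
  have d2 : ∀ c, deriv (deriv fun t => x t c) τ =
      ∑ a, ((∑ b, pd b (fun z => jac φ z c a) (y τ) * deriv (fun s => y s b) τ)
        * deriv (fun s => y s a) τ + jac φ (y τ) c a * deriv (deriv fun s => y s a) τ) := by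
    intro c
    rw [(d1 c).deriv_eq, deriv_fun_sum fun a _ => (hJy c a).fun_mul (hyd a)]
    refine Finset.sum_congr rfl fun a _ => ?_
    rw [deriv_fun_mul (hJy c a) (hyd a), deriv_comp_curve (F := fun z => jac φ z c a) (hJ c a) hyτ]
  ext c
  have hxτ : x τ = φ (y τ) := hx.self_of_nhds
  have d1' : ∀ i, deriv (fun t => x t i) τ = ∑ a, jac φ (y τ) i a * deriv (fun s => y s a) τ :=
    fun i => (d1 i).self_of_nhds
  have key := h.christoffel_transform c
  simp only [geodesicOp, Matrix.mulVec, dotProduct, d2, mul_add, Finset.sum_add_distrib, hxτ]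
  have e1 : ∑ a, jac φ (y τ) c a * ∑ i, ∑ j, christoffel G' (y τ) a i j
        * deriv (fun t => y t i) τ * deriv (fun t => y t j) τ =
      ∑ i, ∑ j, (∑ a, jac φ (y τ) c a * christoffel G' (y τ) a i j)
        * (deriv (fun t => y t i) τ * deriv (fun t => y t j) τ) := by
    simp only [Finset.mul_sum, Finset.sum_mul]
    rw [Finset.sum_comm]
    refine Finset.sum_congr rfl fun i _ => ?_
    rw [Finset.sum_comm]
    exact Finset.sum_congr rfl fun j _ => Finset.sum_congr rfl fun a _ => by ring
  have e2 : ∑ i, ∑ j, christoffel G (φ (y τ)) c i j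
        * deriv (fun t => x t i) τ * deriv (fun t => x t j) τ =
      ∑ a, ∑ b, (∑ j, ∑ k, christoffel G (φ (y τ)) c j k * jac φ (y τ) j a * jac φ (y τ) k b)
        * (deriv (fun t => y t a) τ * deriv (fun t => y t b) τ) := by
    simp only [d1', Finset.mul_sum, Finset.sum_mul]
    calc _ = ∑ i, ∑ j, ∑ a, ∑ b, christoffel G (φ (y τ)) c i j * jac φ (y τ) i a * jac φ (y τ) j b
          * (deriv (fun t => y t a) τ * deriv (fun t => y t b) τ) := by
          refine Finset.sum_congr rfl fun i _ => Finset.sum_congr rfl fun j _ => ?_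
          rw [Finset.sum_comm]
          exact Finset.sum_congr rfl fun a _ => Finset.sum_congr rfl fun b _ => by ring
      _ = ∑ i, ∑ a, ∑ j, ∑ b, christoffel G (φ (y τ)) c i j * jac φ (y τ) i a * jac φ (y τ) j b
          * (deriv (fun t => y t a) τ * deriv (fun t => y t b) τ) :=
          Finset.sum_congr rfl fun i _ => Finset.sum_comm
      _ = ∑ a, ∑ i, ∑ b, ∑ j, christoffel G (φ (y τ)) c i j * jac φ (y τ) i a * jac φ (y τ) j b
          * (deriv (fun t => y t a) τ * deriv (fun t => y t b) τ) := by
          rw [Finset.sum_comm]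
          exact Finset.sum_congr rfl fun a _ => Finset.sum_congr rfl fun i _ => Finset.sum_comm
      _ = _ := Finset.sum_congr rfl fun a _ => Finset.sum_comm
  have e3 : ∑ a, (∑ b, pd b (fun z => jac φ z c a) (y τ) * deriv (fun s => y s b) τ)
        * deriv (fun s => y s a) τ = ∑ a, ∑ b, pd a (fun z => jac φ z c b) (y τ)
        * (deriv (fun s => y s a) τ * deriv (fun s => y s b) τ) := by
    simp only [Finset.sum_mul]
    rw [Finset.sum_comm]
    exact Finset.sum_congr rfl fun a _ => Finset.sum_congr rfl fun b _ => by ring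
  rw [e1, e2, e3]
  simp only [key, add_mul, Finset.sum_add_distrib]
  ring

lemma geodesicOp_eq_zero_iff {x y : ℝ → Coord D} {τ : ℝ} (h : IsPullbackAt φ G G' (y τ))
    (hy : ContDiffAt ℝ 2 y τ) (hx : x =ᶠ[𝓝 τ] fun t => φ (y t)) :
    geodesicOp G x τ = 0 ↔ geodesicOp G' y τ = 0 := by
  have hu : IsUnit (jac φ (y τ)) := (Matrix.isUnit_iff_isUnit_det _).2 h.jac_isUnit.self_of_nhds
  rw [h.geodesicOp_transform hy hx]
  refine ⟨fun h0 => ?_, fun h0 => by rw [h0, Matrix.mulVec_zero]⟩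
  exact Matrix.mulVec_injective_iff_isUnit.2 hu (h0.trans (Matrix.mulVec_zero _).symm)

variable {F F' : Coord D → ℝ} {y : Coord D}

/-- The unit normal covector is a covector. -/
lemma normalCovector_transform (h : IsPullbackAt φ G G' y)
    (hF : ∀ᶠ x in 𝓝 (φ y), DifferentiableAt ℝ F x) (hF' : F' =ᶠ[𝓝 y] fun z => F (φ z)) :
    ∀ᶠ z in 𝓝 y, ∀ b, normalCovector G' F' z b = ∑ i, normalCovector G F (φ z) i * jac φ z i b := by
  filter_upwards [h.eq, h.jac_isUnit, hF'.eventually_nhds, h.contDiffAt.eventually (by simp),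
    h.contDiffAt.continuousAt.eventually hF] with z h1 h2 h3 h4 h5 b
  have hp : ∀ b, pd b F' z = ∑ i, pd i F (φ z) * jac φ z i b := fun b => by
    rw [pd_congr h3, pd_comp h5 (h4.differentiableAt (by norm_num))]
  -- The normalising factor `g^{bc} ∂_b F ∂_c F` is a scalar.
  have hn : ∑ b, ∑ c, (G' z)⁻¹ b c * pd b F' z * pd c F' z =
      ∑ b, ∑ c, (G (φ z))⁻¹ b c * pd b F (φ z) * pd c F (φ z) := by
    have gen : ∀ (A : Matrix (Fin D) (Fin D) ℝ) (v : Fin D → ℝ),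
        ∑ b, ∑ c, A b c * v b * v c = v ⬝ᵥ A.mulVec v := by
      intro A v
      simp only [dotProduct, Matrix.mulVec, Finset.mul_sum]
      exact Finset.sum_congr rfl fun b _ => Finset.sum_congr rfl fun c _ => by ring
    rw [gen _ fun b => pd b F' z, gen _ fun b => pd b F (φ z), ← inv_pullback h1 h2]
    have : (fun b => pd b F' z) = (jac φ z).transpose.mulVec fun b => pd b F (φ z) := by
      ext b
      rw [hp]
      simp [Matrix.mulVec, dotProduct, mul_comm]
    rw [this, ← Matrix.mulVec_mulVec, ← Matrix.mulVec_mulVec, Matrix.dotProduct_mulVec _ (jac φ z),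
      Matrix.mulVec_transpose]
  simp only [normalCovector]
  rw [hn, hp, Finset.sum_div]
  exact Finset.sum_congr rfl fun i _ => by ring

/-- The covariant derivative of the unit normal is a tensor. -/
lemma covDerivNormal_transform (h : IsPullbackAt φ G G' y)
    (hF : ∀ᶠ x in 𝓝 (φ y), DifferentiableAt ℝ F x) (hF' : F' =ᶠ[𝓝 y] fun z => F (φ z))
    (hN : ∀ i, DifferentiableAt ℝ (fun x => normalCovector G F x i) (φ y)) (c b : Fin D) :
    covDerivNormal G' F' y c b =
      ∑ i, ∑ j, covDerivNormal G F (φ y) i j * jac φ y i c * jac φ y j b := by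
  have hφ : DifferentiableAt ℝ φ y := h.contDiffAt.differentiableAt (by norm_num)
  have hJ := differentiableAt_jac h.contDiffAt
  have ev := h.normalCovector_transform hF hF'
  have ev' : (fun z => normalCovector G' F' z b) =ᶠ[𝓝 y]
      fun z => ∑ i, normalCovector G F (φ z) i * jac φ z i b := by
    filter_upwards [ev] with z hz using hz b
  have hNφ : ∀ i, DifferentiableAt ℝ (fun z => normalCovector G F (φ z) i) y := fun i =>
    (hN i).comp y hφ
  -- The terms with derivatives of the Jacobian in `e1` and `e2` are equal, so they drop out of the
  -- difference.
  have e1 : pd c (fun z => normalCovector G' F' z b) y =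
      ∑ i, ∑ j, pd i (fun x => normalCovector G F x j) (φ y) * jac φ y i c * jac φ y j b
        + ∑ i, normalCovector G F (φ y) i * pd c (fun z => jac φ z i b) y := by
    rw [pd_congr ev', pd_sum _ fun i _ => (hNφ i).fun_mul (hJ i b), Finset.sum_comm,
      ← Finset.sum_add_distrib]
    refine Finset.sum_congr rfl fun i _ => ?_
    rw [pd_mul (hNφ i) (hJ i b), pd_comp (F := fun x => normalCovector G F x i) (hN i) hφ,
      Finset.sum_mul]
  have e2 : ∑ d, christoffel G' y d c b * normalCovector G' F' y d =
      ∑ l, normalCovector G F (φ y) l * (∑ j, ∑ k, christoffel G (φ y) l j k * jac φ y j c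
        * jac φ y k b + pd c (fun z => jac φ z l b) y) := by
    simp only [← h.christoffel_transform, ev.self_of_nhds, Finset.mul_sum]
    rw [Finset.sum_comm]
    exact Finset.sum_congr rfl fun d _ => Finset.sum_congr rfl fun l _ => by ring
  have e3 : ∑ i, ∑ j, covDerivNormal G F (φ y) i j * jac φ y i c * jac φ y j b =
      ∑ i, ∑ j, pd i (fun x => normalCovector G F x j) (φ y) * jac φ y i c * jac φ y j b
      - ∑ l, normalCovector G F (φ y) l * ∑ j, ∑ k, christoffel G (φ y) l j k * jac φ y j c
        * jac φ y k b := by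
    have : ∑ l, normalCovector G F (φ y) l * ∑ j, ∑ k, christoffel G (φ y) l j k * jac φ y j c
        * jac φ y k b = ∑ j, ∑ k, (∑ l, christoffel G (φ y) l j k * normalCovector G F (φ y) l)
          * jac φ y j c * jac φ y k b := by
      simp only [Finset.mul_sum, Finset.sum_mul]
      rw [Finset.sum_comm]
      refine Finset.sum_congr rfl fun j _ => ?_
      rw [Finset.sum_comm]
      exact Finset.sum_congr rfl fun k _ => Finset.sum_congr rfl fun l _ => by ring
    rw [this, ← Finset.sum_sub_distrib]
    refine Finset.sum_congr rfl fun i _ => ?_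
    rw [← Finset.sum_sub_distrib]
    exact Finset.sum_congr rfl fun j _ => by rw [covDerivNormal]; ring
  rw [covDerivNormal, e1, e2, e3]
  simp only [mul_add, Finset.sum_add_distrib]
  ring

lemma normalVector_transform (h : IsPullbackAt φ G G' y)
    (hF : ∀ᶠ x in 𝓝 (φ y), DifferentiableAt ℝ F x) (hF' : F' =ᶠ[𝓝 y] fun z => F (φ z)) (i : Fin D) :
    ∑ c, jac φ y i c * normalVector G' F' y c = normalVector G F (φ y) i := by
  have ev := (h.normalCovector_transform hF hF').self_of_nhds
  have e0 : normalCovector G' F' y =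
      (jac φ y).transpose.mulVec (normalCovector G F (φ y)) := by
    ext b
    rw [ev]
    simp [Matrix.mulVec, dotProduct, mul_comm]
  have e1 : normalVector G' F' y = (G' y)⁻¹.mulVec (normalCovector G' F' y) := rfl
  have e2 : normalVector G F (φ y) = (G (φ y))⁻¹.mulVec (normalCovector G F (φ y)) := rfl
  change (jac φ y).mulVec (normalVector G' F' y) i = _
  rw [e1, e2, e0, Matrix.mulVec_mulVec, Matrix.mulVec_mulVec,
    inv_pullback h.eq.self_of_nhds h.jac_isUnit.self_of_nhds]

/-- As a matrix it is the transposed projector `1 - n ⊗ n` times `∇n`. The Jacobian intertwines the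
two projectors (`hP`), and `∇n` is covariant. -/
lemma secondFundamentalForm_transform (h : IsPullbackAt φ G G' y)
    (hF : ∀ᶠ x in 𝓝 (φ y), DifferentiableAt ℝ F x) (hF' : F' =ᶠ[𝓝 y] fun z => F (φ z))
    (hN : ∀ i, DifferentiableAt ℝ (fun x => normalCovector G F x i) (φ y)) :
    Matrix.of (secondFundamentalForm G' F' y) =
      (jac φ y).transpose * Matrix.of (secondFundamentalForm G F (φ y)) * jac φ y := by
  have gen : ∀ (G : Coord D → Matrix (Fin D) (Fin D) ℝ) (F : Coord D → ℝ) (x : Coord D),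
      Matrix.of (secondFundamentalForm G F x) =
        (1 - Matrix.vecMulVec (normalVector G F x) (normalCovector G F x)).transpose
          * Matrix.of (covDerivNormal G F x) := by
    intro G F x
    ext a b
    simp [secondFundamentalForm, Matrix.mul_apply, Matrix.one_apply, Matrix.vecMulVec_apply]
    exact Finset.sum_congr rfl fun c _ => by simp only [eq_comm, mul_comm]
  have hc : Matrix.of (covDerivNormal G' F' y) =
      (jac φ y).transpose * Matrix.of (covDerivNormal G F (φ y)) * jac φ y := by
    ext c b
    rw [Matrix.of_apply, h.covDerivNormal_transform hF hF' hN]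
    simp only [Matrix.mul_apply, Matrix.transpose_apply, Finset.sum_mul, Matrix.of_apply]
    rw [Finset.sum_comm]
    exact Finset.sum_congr rfl fun d _ => Finset.sum_congr rfl fun l _ => by ring
  have hP : jac φ y * (1 - Matrix.vecMulVec (normalVector G' F' y) (normalCovector G' F' y)) =
      (1 - Matrix.vecMulVec (normalVector G F (φ y)) (normalCovector G F (φ y))) * jac φ y := by
    have h1 : (jac φ y).mulVec (normalVector G' F' y) = normalVector G F (φ y) :=
      funext (h.normalVector_transform hF hF')
    have h2 : Matrix.vecMul (normalCovector G F (φ y)) (jac φ y) = normalCovector G' F' y := by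
      ext b
      rw [(h.normalCovector_transform hF hF').self_of_nhds]
      rfl
    rw [mul_sub, sub_mul, Matrix.mul_vecMulVec, Matrix.vecMulVec_mul, h1, h2, one_mul, mul_one]
  rw [gen, gen, hc, ← mul_assoc, ← mul_assoc, ← Matrix.transpose_mul, hP, Matrix.transpose_mul,
    mul_assoc (jac φ y).transpose]

/-- A contravariant matrix contracted with a covariant one: the Jacobians cancel by cyclicity of the
trace. -/
lemma meanTrace_transform (h : IsPullbackAt φ G G' y)
    (hF : ∀ᶠ x in 𝓝 (φ y), DifferentiableAt ℝ F x) (hF' : F' =ᶠ[𝓝 y] fun z => F (φ z))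
    (hN : ∀ i, DifferentiableAt ℝ (fun x => normalCovector G F x i) (φ y)) :
    meanTrace G' F' y = meanTrace G F (φ y) := by
  have gen : ∀ (G : Coord D → Matrix (Fin D) (Fin D) ℝ) (F : Coord D → ℝ) (x : Coord D),
      meanTrace G F x = (((G x)⁻¹ - Matrix.vecMulVec (normalVector G F x) (normalVector G F x))
          * (Matrix.of (secondFundamentalForm G F x)).transpose).trace := by
    intro G F x
    simp [meanTrace, Matrix.trace, Matrix.mul_apply, Matrix.vecMulVec_apply]
  have hP : jac φ y * ((G' y)⁻¹ - Matrix.vecMulVec (normalVector G' F' y) (normalVector G' F' y))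
      * (jac φ y).transpose =
      (G (φ y))⁻¹ - Matrix.vecMulVec (normalVector G F (φ y)) (normalVector G F (φ y)) := by
    have h1 : (jac φ y).mulVec (normalVector G' F' y) = normalVector G F (φ y) :=
      funext (h.normalVector_transform hF hF')
    rw [mul_sub, sub_mul, Matrix.mul_vecMulVec, Matrix.vecMulVec_mul, h1, Matrix.vecMul_transpose,
      h1, inv_pullback h.eq.self_of_nhds h.jac_isUnit.self_of_nhds]
  rw [gen, gen, ← hP, h.secondFundamentalForm_transform hF hF' hN, Matrix.transpose_mul,
    Matrix.transpose_mul, Matrix.transpose_transpose, ← mul_assoc, ← mul_assoc, Matrix.trace_mul_comm,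
    ← mul_assoc, ← mul_assoc]

/-- The trace-free part of the second fundamental form is a tensor. -/
lemma traceFreePart_transform (h : IsPullbackAt φ G G' y)
    (hF : ∀ᶠ x in 𝓝 (φ y), DifferentiableAt ℝ F x) (hF' : F' =ᶠ[𝓝 y] fun z => F (φ z))
    (hN : ∀ i, DifferentiableAt ℝ (fun x => normalCovector G F x i) (φ y)) :
    Matrix.of (traceFreePart G' F' y) =
      (jac φ y).transpose * Matrix.of (traceFreePart G F (φ y)) * jac φ y := by
  have gen : ∀ (G : Coord D → Matrix (Fin D) (Fin D) ℝ) (F : Coord D → ℝ) (x : Coord D),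
      Matrix.of (traceFreePart G F x) = Matrix.of (secondFundamentalForm G F x)
        - (1 / ((D : ℝ) - 1) * meanTrace G F x) •
          (G x - Matrix.vecMulVec (normalCovector G F x) (normalCovector G F x)) := by
    intro G F x
    ext a b
    simp [traceFreePart, inducedMetric, Matrix.vecMulVec_apply]
  have h2 : Matrix.vecMul (normalCovector G F (φ y)) (jac φ y) = normalCovector G' F' y := by
    ext b
    rw [(h.normalCovector_transform hF hF').self_of_nhds]
    rfl
  rw [gen, gen, h.secondFundamentalForm_transform hF hF' hN, h.meanTrace_transform hF hF' hN,
    h.eq.self_of_nhds, mul_sub, sub_mul, Matrix.mul_smul, Matrix.smul_mul, mul_sub, sub_mul,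
    Matrix.mul_vecMulVec, Matrix.vecMulVec_mul, Matrix.mulVec_transpose, h2]

lemma traceFreePart_eq_zero_iff (h : IsPullbackAt φ G G' y)
    (hF : ∀ᶠ x in 𝓝 (φ y), DifferentiableAt ℝ F x) (hF' : F' =ᶠ[𝓝 y] fun z => F (φ z))
    (hN : ∀ i, DifferentiableAt ℝ (fun x => normalCovector G F x i) (φ y)) :
    (∀ a b, traceFreePart G' F' y a b = 0) ↔ ∀ a b, traceFreePart G F (φ y) a b = 0 := by
  have gen : ∀ A : Fin D → Fin D → ℝ, (∀ a b, A a b = 0) ↔ Matrix.of A = 0 := fun A =>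
    ⟨fun hA => Matrix.ext hA, fun hA a b => congrFun (congrFun hA a) b⟩
  have hu := (Matrix.isUnit_iff_isUnit_det _).2 h.jac_isUnit.self_of_nhds
  rw [gen, gen, h.traceFreePart_transform hF hF' hN, hu.mul_left_eq_zero,
    ((Matrix.isUnit_transpose _).2 hu).mul_right_eq_zero]

end IsPullbackAt

end Coordinates

/-! ### Geodesics and coordinate hypersurfaces of a diagonal metric. -/

section Coordinates

variable {D : ℕ}

/-- Reduces partial derivatives to one-variable calculus along a coordinate line, where the other
coordinates are visibly constant. -/
lemma hasDerivAt_update_pd {u : Coord D → ℝ} {x : Coord D} (h : DifferentiableAt ℝ u x)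
    (a : Fin D) : HasDerivAt (fun s => u (Function.update x a s)) (pd a u x) (x a) := by
  have h1 : HasDerivAt (Function.update x a) (Pi.single a (1 : ℝ)) (x a) :=
    hasDerivAt_update x a (x a)
  have h2 : HasFDerivAt u (fderiv ℝ u x) (Function.update x a (x a)) := by
    rw [Function.update_eq_self]
    exact h.hasFDerivAt
  exact h2.comp_hasDerivAt (x a) h1

/-! ### Diagonal metrics -/

/-- The diagonal metric with coefficients `q`. -/
def diagMetric (q : Coord D → Fin D → ℝ) (x : Coord D) : Matrix (Fin D) (Fin D) ℝ :=
  Matrix.diagonal (q x)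

lemma inv_diagMetric {q : Coord D → Fin D → ℝ} {x : Coord D} (h : ∀ a, q x a ≠ 0) :
    (diagMetric q x)⁻¹ = Matrix.diagonal fun a => (q x a)⁻¹ := by
  refine Matrix.inv_eq_right_inv ?_
  rw [diagMetric, Matrix.diagonal_mul_diagonal]
  simp [h]

lemma pd_diagMetric (q : Coord D → Fin D → ℝ) (x : Coord D) (d a b : Fin D) :
    pd d (fun y => diagMetric q y a b) x = if a = b then pd d (fun y => q y a) x else 0 := by
  by_cases h : a = b
  · subst h
    simp [diagMetric]
  · simp [diagMetric, h, pd_const]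

lemma christoffel_diagMetric {q : Coord D → Fin D → ℝ} {x : Coord D} (h : ∀ a, q x a ≠ 0)
    (c a b : Fin D) : christoffel (diagMetric q) x c a b = 1 / 2 * (q x c)⁻¹ *
      ((if c = b then pd a (fun y => q y c) x else 0)
        + (if c = a then pd b (fun y => q y c) x else 0)
        - if a = b then pd c (fun y => q y a) x else 0) := by
  simp only [christoffel, inv_diagMetric h, pd_diagMetric]
  rw [Finset.sum_eq_single c]
  · simp [mul_assoc]
  · intro d _ hd
    simp [Matrix.diagonal_apply_ne _ hd.symm]
  · simp

/-- The acceleration `-Γ^c_{ab} u^a u^b` of a geodesic of a diagonal metric. -/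
def diagAccel (q : Coord D → Fin D → ℝ) (x u : Coord D) (c : Fin D) : ℝ :=
  (q x c)⁻¹ * (1 / 2 * ∑ b, pd c (fun y => q y b) x * u b ^ 2
    - ∑ b, pd b (fun y => q y c) x * u b * u c)

lemma sum_christoffel_diagMetric {q : Coord D → Fin D → ℝ} {x : Coord D} (h : ∀ a, q x a ≠ 0)
    (u : Coord D) (c : Fin D) :
    ∑ a, ∑ b, christoffel (diagMetric q) x c a b * u a * u b = -diagAccel q x u c := by
  have e1 : ∑ a, ∑ b, (if c = b then pd a (fun y => q y c) x else 0) * u a * u b =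
      ∑ b, pd b (fun y => q y c) x * u b * u c := by
    refine Finset.sum_congr rfl fun a _ => ?_
    simp only [ite_mul, zero_mul, Finset.sum_ite_eq, Finset.mem_univ, if_true]
  have e2 : ∑ a, ∑ b, (if c = a then pd b (fun y => q y c) x else 0) * u a * u b =
      ∑ b, pd b (fun y => q y c) x * u b * u c := by
    rw [Finset.sum_comm]
    refine Finset.sum_congr rfl fun a _ => ?_
    simp only [ite_mul, zero_mul, Finset.sum_ite_eq, Finset.mem_univ, if_true]
    ring
  have e3 : ∑ a, ∑ b, (if a = b then pd c (fun y => q y a) x else 0) * u a * u b =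
      ∑ b, pd c (fun y => q y b) x * u b ^ 2 := by
    refine Finset.sum_congr rfl fun a _ => ?_
    simp only [ite_mul, zero_mul, Finset.sum_ite_eq, Finset.mem_univ, if_true]
    ring
  have : ∀ a b, christoffel (diagMetric q) x c a b * u a * u b = 1 / 2 * (q x c)⁻¹ *
      ((if c = b then pd a (fun y => q y c) x else 0) * u a * u b
        + (if c = a then pd b (fun y => q y c) x else 0) * u a * u b
        - (if a = b then pd c (fun y => q y a) x else 0) * u a * u b) := fun a b => by
    rw [christoffel_diagMetric h]
    ring
  simp only [this, ← Finset.mul_sum, Finset.sum_add_distrib, Finset.sum_sub_distrib]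
  rw [e1, e2, e3, diagAccel]
  ring

lemma geodesicOp_diagMetric {q : Coord D → Fin D → ℝ} {x : ℝ → Coord D} {τ : ℝ}
    (h : ∀ a, q (x τ) a ≠ 0) (c : Fin D) : geodesicOp (diagMetric q) x τ c =
      deriv (deriv fun t => x t c) τ - diagAccel q (x τ) (fun a => deriv (fun t => x t a) τ) c := by
  rw [geodesicOp, sum_christoffel_diagMetric h fun a => deriv (fun t => x t a) τ]
  ring

/-- Conservation of the norm of the velocity along a geodesic. -/
lemma hasDerivAt_diag_energy {q : Coord D → Fin D → ℝ} {x u : ℝ → Coord D} {τ : ℝ}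
    (h : ∀ a, q (x τ) a ≠ 0) (hq : ∀ a, DifferentiableAt ℝ (fun y => q y a) (x τ))
    (hx : HasDerivAt x (u τ) τ) (hu : HasDerivAt u (diagAccel q (x τ) (u τ)) τ) :
    HasDerivAt (fun t => ∑ a, q (x t) a * u t a ^ 2) 0 τ := by
  have h1 : ∀ a, HasDerivAt (fun t => q (x t) a) (∑ b, pd b (fun y => q y a) (x τ) * u τ b) τ := by
    intro a
    have := (hq a).hasFDerivAt.comp_hasDerivAt τ hx
    rw [fderiv_apply_eq_sum_pd] at this
    exact this.congr_deriv (Finset.sum_congr rfl fun b _ => mul_comm _ _)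
  have h2 := HasDerivAt.fun_sum (u := Finset.univ) fun a _ =>
    (h1 a).fun_mul ((hasDerivAt_pi.1 hu a).fun_pow 2)
  refine h2.congr_deriv ?_
  -- With `A a b = ∂_a q_b u_a u_b²`, the summand for `a` is `∑ b, (A a b - A b a)`, so the sum over
  -- `a` vanishes.
  have e : ∀ a, (∑ b, pd b (fun y => q y a) (x τ) * u τ b) * u τ a ^ 2
      + q (x τ) a * (((2 : ℕ) : ℝ) * u τ a ^ (2 - 1) * diagAccel q (x τ) (u τ) a) =
      ∑ b, pd a (fun y => q y b) (x τ) * u τ a * u τ b ^ 2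
        - ∑ b, pd b (fun y => q y a) (x τ) * u τ b * u τ a ^ 2 := by
    intro a
    have i1 : ∑ b, pd a (fun y => q y b) (x τ) * u τ a * u τ b ^ 2 =
        u τ a * ∑ b, pd a (fun y => q y b) (x τ) * u τ b ^ 2 := by
      rw [Finset.mul_sum]
      exact Finset.sum_congr rfl fun b _ => by ring
    have i2 : ∑ b, pd b (fun y => q y a) (x τ) * u τ b * u τ a ^ 2 =
        (∑ b, pd b (fun y => q y a) (x τ) * u τ b) * u τ a ^ 2 := by rw [Finset.sum_mul]
    have i3 : ∑ b, pd b (fun y => q y a) (x τ) * u τ b * u τ a =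
        (∑ b, pd b (fun y => q y a) (x τ) * u τ b) * u τ a := by rw [Finset.sum_mul]
    rw [i1, i2, diagAccel, i3]
    have := h a
    field_simp
    push_cast
    ring
  rw [Finset.sum_congr rfl fun a _ => e a, Finset.sum_sub_distrib]
  rw [sub_eq_zero, Finset.sum_comm]

section Normal

variable {q : Coord D → Fin D → ℝ} {x : Coord D} {i : Fin D}

lemma normalCovector_diagMetric (h : ∀ a, q x a ≠ 0) (b : Fin D) :
    normalCovector (diagMetric q) (fun y => y i) x b = if b = i then √(q x i) else 0 := by
  have : ∑ b, ∑ c, (diagMetric q x)⁻¹ b c * pd b (fun y : Coord D => y i) x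
      * pd c (fun y : Coord D => y i) x = (q x i)⁻¹ := by
    simp [inv_diagMetric h, pd_coord]
  rw [normalCovector, this, pd_coord, Real.sqrt_inv]
  by_cases hb : b = i
  · subst hb
    simp
  · rw [if_neg (Ne.symm hb), if_neg hb, zero_div]

lemma normalVector_diagMetric (h : ∀ a, q x a ≠ 0) (hi : 0 < q x i) (b : Fin D) :
    normalVector (diagMetric q) (fun y => y i) x b = if b = i then (√(q x i))⁻¹ else 0 := by
  have hs : √(q x i) ≠ 0 := (Real.sqrt_pos.2 hi).ne'
  rw [normalVector]
  simp only [inv_diagMetric h, normalCovector_diagMetric h, mul_ite, mul_zero, Finset.sum_ite_eq',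
    Finset.mem_univ, if_true, Matrix.diagonal_apply]
  by_cases hb : b = i
  · subst hb
    have := Real.mul_self_sqrt hi.le
    simp only [if_true]
    rw [inv_mul_eq_iff_eq_mul₀ hi.ne', ← div_eq_mul_inv, eq_div_iff hs, this]
  · simp [hb]

lemma differentiableAt_normalCovector_diagMetric (h : ∀ᶠ z in 𝓝 x, ∀ a, q z a ≠ 0)
    (hi : 0 < q x i) (hd : DifferentiableAt ℝ (fun y => q y i) x) (b : Fin D) :
    DifferentiableAt ℝ (fun z => normalCovector (diagMetric q) (fun y => y i) z b) x := by
  have ev : (fun z => normalCovector (diagMetric q) (fun y => y i) z b) =ᶠ[𝓝 x]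
      fun z => if b = i then √(q z i) else 0 := by
    filter_upwards [h] with z hz using normalCovector_diagMetric hz b
  refine DifferentiableAt.congr_of_eventuallyEq ?_ ev
  by_cases hb : b = i
  · simpa only [hb, if_true] using hd.sqrt hi.ne'
  · simp only [hb, if_false]
    exact differentiableAt_const _

/-- The normal is `n_b = √q_i δ_{bi}`. The projector removes the row `a = i`. For `a ≠ i` the
coefficient `q_i` does not vary along `x_a`, so only `-Γ^i_{ab} n_i` survives, and it is diagonal.
-/
lemma secondFundamentalForm_diagMetric (h : ∀ᶠ z in 𝓝 x, ∀ a, q z a ≠ 0) (hi : 0 < q x i)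
    (hd : DifferentiableAt ℝ (fun y => q y i) x) (hp : ∀ a ≠ i, pd a (fun y => q y i) x = 0)
    (a b : Fin D) : secondFundamentalForm (diagMetric q) (fun y => y i) x a b =
      if a = b ∧ a ≠ i then pd i (fun y => q y a) x / (2 * √(q x i)) else 0 := by
  have hx := h.self_of_nhds
  have hs : √(q x i) ≠ 0 := (Real.sqrt_pos.2 hi).ne'
  have hN := normalCovector_diagMetric (i := i) hx
  have hV := normalVector_diagMetric hx hi
  rw [secondFundamentalForm, Finset.sum_eq_single a]
  · by_cases ha : a = i
    · subst ha
      simp [hN, hV, hs]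
    · have ev : (fun z => normalCovector (diagMetric q) (fun y => y i) z b) =ᶠ[𝓝 x]
          fun z => if b = i then √(q z i) else 0 := by
        filter_upwards [h] with z hz using normalCovector_diagMetric hz b
      have hpd : pd a (fun z => if b = i then √(q z i) else 0) x = 0 := by
        by_cases hb : b = i
        · have := hp a ha
          simp only [pd] at this
          simp only [hb, if_true, pd, fderiv_sqrt hd hi.ne']
          simp [this]
        · simp [hb, pd_const]
      rw [covDerivNormal, pd_congr ev, hpd]
      simp only [hN, ha, if_false, mul_zero, mul_ite, Finset.sum_ite_eq', Finset.mem_univ, if_true,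
        christoffel_diagMetric hx, hp a ha, Ne.symm ha, ite_self, ne_eq, not_false_eq_true, and_true]
      by_cases hab : a = b
      · simp only [hab, if_true]
        have e := Real.mul_self_sqrt hi.le
        rw [eq_div_iff (by positivity)]
        field_simp
        linear_combination pd i (fun y => q y b) x * e
      · simp [hab]
  · intro c _ hca
    by_cases hc : c = i
    · have : ¬ a = i := fun hai => hca (hc.trans hai.symm)
      simp [hN, this, hca]
    · simp [hV, hc, hca]
  · simp

/-- The principal curvatures are `μ a / (2√q_i)`, so the trace-free part measures how far each `μ a`
is from the mean over the `D - 1` tangential directions. The value `μ i` plays no role. -/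
lemma traceFreePart_diagMetric (h : ∀ᶠ z in 𝓝 x, ∀ a, q z a ≠ 0) (hi : 0 < q x i)
    (hd : DifferentiableAt ℝ (fun y => q y i) x) (hp : ∀ a ≠ i, pd a (fun y => q y i) x = 0)
    {μ : Fin D → ℝ} (hμ : ∀ a ≠ i, pd i (fun y => q y a) x = μ a * q x a) (a b : Fin D) :
    traceFreePart (diagMetric q) (fun y => y i) x a b =
      if a = b ∧ a ≠ i then q x a / (2 * √(q x i)) *
        (μ a - 1 / ((D : ℝ) - 1) * ∑ c, if c = i then 0 else μ c) else 0 := by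
  have hx := h.self_of_nhds
  have hs : √(q x i) ≠ 0 := (Real.sqrt_pos.2 hi).ne'
  have hN := normalCovector_diagMetric (i := i) hx
  have hV := normalVector_diagMetric hx hi
  have hS := secondFundamentalForm_diagMetric h hi hd hp
  have hT : meanTrace (diagMetric q) (fun y => y i) x =
      (2 * √(q x i))⁻¹ * ∑ c, if c = i then 0 else μ c := by
    rw [meanTrace, Finset.mul_sum]
    refine Finset.sum_congr rfl fun a _ => ?_
    rw [Finset.sum_eq_single a]
    · rw [hS, inv_diagMetric hx, Matrix.diagonal_apply_eq, hV]
      by_cases ha : a = i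
      · simp [ha]
      · simp only [ha, if_false, hμ a ha, ne_eq, not_false_eq_true, and_self, if_true]
        have := hx a
        field_simp
        ring
    · intro b _ hb
      rw [hS, if_neg fun hc => hb hc.1.symm, mul_zero]
    · simp
  rw [traceFreePart, hS, hT, inducedMetric, hN, hN, diagMetric]
  by_cases hab : a = b
  · subst hab
    by_cases ha : a = i
    · subst ha
      simp [Real.mul_self_sqrt hi.le]
    · simp only [ha, Matrix.diagonal_apply_eq, hμ a ha, ne_eq, not_false_eq_true, and_self, if_true,
        if_false]
      ring
  · by_cases ha : a = i
    · have : ¬ b = i := fun hb => hab (ha.trans hb.symm)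
      simp [hab, this]
    · simp [hab, ha]

end Normal

end Coordinates

/-! ### The static metrics: radial logarithmic derivatives and their consequences. -/

section Static

variable {n : ℕ} {κ : SpatialSymmetry} {J : Set ℝ} {f g : ℝ → ℝ} {x : Coord (n + 3)}

lemma coe_two_fin (n : ℕ) : ((2 : Fin (n + 3)) : ℕ) = 2 := Nat.mod_eq_of_lt (show 2 < n + 3 by omega)

lemma two_ne_one_fin (n : ℕ) : (2 : Fin (n + 3)) ≠ 1 := fun h => by
  have := congrArg Fin.val h
  rw [coe_two_fin, Fin.val_one] at this
  omega

lemma two_ne_zero_fin (n : ℕ) : (2 : Fin (n + 3)) ≠ 0 := fun h => by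
  have := congrArg Fin.val h
  rw [coe_two_fin, Fin.val_zero] at this
  omega

/-- The coefficients of the metric of the unit space of constant curvature, and `1` for `a ≤ 2`. -/
def angularCoeff (κ : SpatialSymmetry) (x : Coord (n + 3)) (a : Fin (n + 3)) : ℝ :=
  if a.val ≤ 2 then 1 else κ.s (x 2) ^ 2 *
    ∏ l : Fin (n + 3) with 3 ≤ l.val ∧ l < a, Real.sin (x l) ^ 2

lemma staticCoeff_zero : staticCoeff n κ f g x 0 = -f (x 1) := by simp [staticCoeff]

lemma staticCoeff_one : staticCoeff n κ f g x 1 = g (x 1) := by simp [staticCoeff]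

/-- Isolates the whole `r`-dependence in the factor `r²`, since `angularCoeff` does not involve `x
1` (`angularCoeff_update`). -/
lemma staticCoeff_of_ne {a : Fin (n + 3)} (h0 : a ≠ 0) (h1 : a ≠ 1) :
    staticCoeff n κ f g x a = x 1 ^ 2 * angularCoeff κ x a := by
  by_cases h2 : a = 2
  · subst h2
    rw [angularCoeff, if_pos (coe_two_fin n).le, mul_one]
    simp only [staticCoeff, h0, h1, if_false, if_true]
  · have : ¬ a.val ≤ 2 := by
      intro h
      have e0 : a.val ≠ 0 := fun h => h0 (Fin.ext h)
      have e1 : a.val ≠ 1 := fun h => h1 (Fin.ext h)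
      have e2 : a.val ≠ 2 := fun h => h2 (Fin.ext (h.trans (coe_two_fin n).symm))
      omega
    simp [staticCoeff, angularCoeff, h0, h1, h2, this]

lemma angularCoeff_update (s : ℝ) (a : Fin (n + 3)) :
    angularCoeff κ (Function.update x 1 s) a = angularCoeff κ x a := by
  rw [angularCoeff, angularCoeff, Function.update_of_ne (two_ne_one_fin n)]
  congr 2
  refine Finset.prod_congr rfl fun l hl => ?_
  have : l ≠ 1 := by
    rintro rfl
    simp at hl
  rw [Function.update_of_ne this]

lemma contDiff_s (κ : SpatialSymmetry) : ContDiff ℝ ∞ κ.s := by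
  cases κ
  · exact Real.contDiff_sin
  · exact contDiff_id
  · exact Real.contDiff_sinh

lemma s_pos {χ : ℝ} (h : χ ∈ κ.chiRange) : 0 < κ.s χ := by
  cases κ
  · exact Real.sin_pos_of_mem_Ioo h
  · exact h
  · exact Real.sinh_pos_iff.2 h

lemma contDiff_angularCoeff (a : Fin (n + 3)) :
    ContDiff ℝ ∞ fun x : Coord (n + 3) => angularCoeff κ x a := by
  by_cases h : a.val ≤ 2
  · simpa only [angularCoeff, h, if_true] using contDiff_const
  · simp only [angularCoeff, h, if_false]
    exact (((contDiff_s κ).comp (contDiff_apply ℝ ℝ 2)).pow 2).mul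
      (contDiff_prod fun l _ => (Real.contDiff_sin.comp (contDiff_apply ℝ ℝ l)).pow 2)

lemma angularCoeff_pos (hx : x ∈ coordRange n κ J) (a : Fin (n + 3)) : 0 < angularCoeff κ x a := by
  rw [angularCoeff]
  split_ifs with h
  · exact one_pos
  · refine mul_pos (pow_pos (s_pos hx.2.1) 2) (Finset.prod_pos fun l hl => ?_)
    rw [Finset.mem_filter] at hl
    refine pow_pos (Real.sin_pos_of_mem_Ioo (hx.2.2 l hl.2.1 ?_)) 2
    -- From `l < a ≤ n + 2` the product never meets the last angle, the one whose range is
    -- unrestricted.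
    have := a.isLt
    have := Fin.lt_def.1 hl.2.2
    omega

lemma isOpen_coordRange (hJ : IsOpen J) : IsOpen (coordRange n κ J) := by
  have hχ : IsOpen κ.chiRange := by
    cases κ
    · exact isOpen_Ioo
    · exact isOpen_Ioi
    · exact isOpen_Ioi
  refine (hJ.preimage (continuous_apply 1)).inter ((hχ.preimage (continuous_apply 2)).inter ?_)
  have : {x : Coord (n + 3) | ∀ l : Fin (n + 3), 3 ≤ l.val → l.val < n + 2 →
      x l ∈ Set.Ioo 0 Real.pi} = ⋂ l : Fin (n + 3), ⋂ _ : 3 ≤ l.val, ⋂ _ : l.val < n + 2,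
        (fun x : Coord (n + 3) => x l) ⁻¹' Set.Ioo 0 Real.pi := by
    ext x
    simp
  change IsOpen {x : Coord (n + 3) | ∀ l : Fin (n + 3), 3 ≤ l.val → l.val < n + 2 →
      x l ∈ Set.Ioo 0 Real.pi}
  rw [this]
  exact isOpen_iInter_of_finite fun l => isOpen_iInter_of_finite fun _ =>
    isOpen_iInter_of_finite fun _ => isOpen_Ioo.preimage (continuous_apply l)

variable (hJ : IsOpen J) (hJpos : ∀ r ∈ J, 0 < r) (hf : ContDiffOn ℝ 1 f J)
  (hg : ContDiffOn ℝ 1 g J) (hfpos : ∀ r ∈ J, 0 < f r) (hgpos : ∀ r ∈ J, 0 < g r)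

section
include hJpos hfpos hgpos

lemma staticCoeff_ne_zero (hx : x ∈ coordRange n κ J) (a : Fin (n + 3)) :
    staticCoeff n κ f g x a ≠ 0 := by
  by_cases h0 : a = 0
  · subst h0
    rw [staticCoeff_zero]
    exact (neg_neg_of_pos (hfpos _ hx.1)).ne
  by_cases h1 : a = 1
  · subst h1
    rw [staticCoeff_one]
    exact (hgpos _ hx.1).ne'
  rw [staticCoeff_of_ne h0 h1]
  exact (mul_pos (pow_pos (hJpos _ hx.1) 2) (angularCoeff_pos hx a)).ne'

end

lemma differentiableAt_of_contDiffOn_one {u : ℝ → ℝ} (hJ : IsOpen J) (hu : ContDiffOn ℝ 1 u J)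
    {r : ℝ} (hr : r ∈ J) : DifferentiableAt ℝ u r :=
  (hu.contDiffAt (hJ.mem_nhds hr)).differentiableAt (by norm_num)

section
include hJ hf hg

lemma differentiableAt_staticCoeff (hx : x 1 ∈ J) (a : Fin (n + 3)) :
    DifferentiableAt ℝ (fun y => staticCoeff n κ f g y a) x := by
  have h1 : DifferentiableAt ℝ (fun y : Coord (n + 3) => y 1) x := differentiableAt_apply 1 x
  by_cases h0 : a = 0
  · subst h0
    simp only [staticCoeff_zero]
    exact (DifferentiableAt.comp (f := fun y : Coord (n + 3) => y 1) x
      (differentiableAt_of_contDiffOn_one hJ hf hx) h1).neg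
  by_cases h2 : a = 1
  · subst h2
    simp only [staticCoeff_one]
    exact DifferentiableAt.comp (f := fun y : Coord (n + 3) => y 1) x
      (differentiableAt_of_contDiffOn_one hJ hg hx) h1
  simp only [staticCoeff_of_ne h0 h2]
  exact (h1.pow 2).mul ((contDiff_angularCoeff a).contDiffAt.differentiableAt (by simp))

/-- These are the logarithmic derivatives `μ_a`: `f'/f` in the time direction and `2/r` in every
other direction tangent to the level sets of `r`. -/
lemma pd_staticCoeff_radial {a : Fin (n + 3)} (ha : a ≠ 1) (hx : x 1 ∈ J) (hx0 : 0 < x 1)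
    (hfx : 0 < f (x 1)) : pd 1 (fun y => staticCoeff n κ f g y a) x =
      (if a = 0 then deriv f (x 1) / f (x 1) else 2 / x 1) * staticCoeff n κ f g x a := by
  refine (hasDerivAt_update_pd (differentiableAt_staticCoeff hJ hf hg hx a) 1).unique ?_
  by_cases h0 : a = 0
  · subst h0
    simp only [staticCoeff_zero, Function.update_self, if_true]
    refine (differentiableAt_of_contDiffOn_one hJ hf hx).hasDerivAt.fun_neg.congr_deriv ?_
    field_simp
  · simp only [staticCoeff_of_ne h0 ha, Function.update_self, angularCoeff_update, if_neg h0]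
    refine ((hasDerivAt_pow 2 (x 1)).mul_const (angularCoeff κ x a)).congr_deriv ?_
    have := hx0.ne'
    field_simp
    ring

lemma pd_staticCoeff_one {c : Fin (n + 3)} (hc : c ≠ 1) (hx : x 1 ∈ J) :
    pd c (fun y => staticCoeff n κ f g y 1) x = 0 := by
  refine (hasDerivAt_update_pd (differentiableAt_staticCoeff hJ hf hg hx 1) c).unique ?_
  simp only [staticCoeff_one, Function.update_of_ne hc.symm]
  exact hasDerivAt_const _ _

end

section
include hJ hf

lemma deriv_div_sq_eq_zero_iff {r : ℝ} (hr : r ∈ J) (hr0 : 0 < r) (hfr : 0 < f r) :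
    deriv (fun r => f r / r ^ 2) r = 0 ↔ deriv f r / f r = 2 / r := by
  have h := (differentiableAt_of_contDiffOn_one hJ hf hr).hasDerivAt.fun_div (hasDerivAt_pow 2 r)
    (pow_pos hr0 2).ne'
  rw [h.deriv, div_eq_zero_iff, or_iff_left (by positivity), div_eq_div_iff hfr.ne' hr0.ne']
  push_cast
  constructor
  · intro h
    have : r * (deriv f r * r - 2 * f r) = 0 := by linear_combination h
    rcases mul_eq_zero.1 this with h | h
    · exact absurd h hr0.ne'
    · linear_combination h
  · intro h
    linear_combination r * h

end

/-! ### The radial component of the geodesic equation, and the second fundamental form -/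

section
include hJ hJpos hf hg hfpos

/-- The radial acceleration of a null geodesic tangent to a level set of the radius. -/
lemma diagAccel_staticCoeff_radial (hx : x ∈ coordRange n κ J) {u : Coord (n + 3)} (hu : u 1 = 0)
    (hnull : ∑ a, staticCoeff n κ f g x a * u a ^ 2 = 0) :
    diagAccel (staticCoeff n κ f g) x u 1 =
      (g (x 1))⁻¹ * (1 / 2 * ((2 / x 1 - deriv f (x 1) / f (x 1)) * f (x 1) * u 0 ^ 2)) := by
  have h1 : ∑ b, pd 1 (fun y => staticCoeff n κ f g y b) x * u b ^ 2 =
      (2 / x 1 - deriv f (x 1) / f (x 1)) * f (x 1) * u 0 ^ 2 := by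
    -- Differentiating in `r` multiplies every term by `2/r`, up to a correction for `b = 0`; the
    -- term `b = 1` vanishes with `u 1`. Nullity then removes the common part and leaves the
    -- correction.
    have : ∀ b, pd 1 (fun y => staticCoeff n κ f g y b) x * u b ^ 2 =
        2 / x 1 * (staticCoeff n κ f g x b * u b ^ 2) +
          if b = 0 then (2 / x 1 - deriv f (x 1) / f (x 1)) * f (x 1) * u 0 ^ 2 else 0 := by
      intro b
      by_cases hb : b = 1
      · subst hb
        simp [hu]
      · rw [pd_staticCoeff_radial hJ hf hg hb hx.1 (hJpos _ hx.1) (hfpos _ hx.1)]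
        by_cases h0 : b = 0
        · subst h0
          simp only [if_true, staticCoeff_zero]
          ring
        · simp only [h0, if_false]
          ring
    rw [Finset.sum_congr rfl fun b _ => this b, Finset.sum_add_distrib, ← Finset.mul_sum, hnull]
    simp
  rw [diagAccel, h1, staticCoeff_one]
  simp [hu]

include hgpos in
-- Among the `n + 2` values `μ_a`, one is `f'/f` and `n + 1 ≥ 1` are `2/r`; they all equal their
-- mean iff these two numbers agree.
lemma traceFreePart_static_eq_zero_iff (hx : x ∈ coordRange n κ J) :
    (∀ a b, traceFreePart (diagMetric (staticCoeff n κ f g)) (fun y => y 1) x a b = 0) ↔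
      deriv f (x 1) / f (x 1) = 2 / x 1 := by
  have hne : ∀ᶠ z in 𝓝 x, ∀ a, staticCoeff n κ f g z a ≠ 0 := by
    filter_upwards [(isOpen_coordRange hJ).mem_nhds hx] with z hz a
    exact staticCoeff_ne_zero hJpos hfpos hgpos hz a
  have hpos : 0 < staticCoeff n κ f g x 1 := by
    rw [staticCoeff_one]
    exact hgpos _ hx.1
  have key := traceFreePart_diagMetric hne hpos (differentiableAt_staticCoeff hJ hf hg hx.1 1)
    (fun a ha => pd_staticCoeff_one hJ hf hg ha hx.1) (fun a ha =>
      pd_staticCoeff_radial hJ hf hg ha hx.1 (hJpos _ hx.1) (hfpos _ hx.1))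
  have hsum : (∑ c : Fin (n + 3), if c = 1 then 0 else
      if c = 0 then deriv f (x 1) / f (x 1) else 2 / x 1) =
      deriv f (x 1) / f (x 1) + (n + 1) * (2 / x 1) := by
    rw [Fin.sum_univ_succ, Fin.sum_univ_succ]
    have h1 : ∀ i : Fin (n + 1), i.succ.succ ≠ 1 := fun i h =>
      Fin.succ_ne_zero i (Fin.succ_injective _ (h.trans Fin.succ_zero_eq_one.symm))
    simp only [h1, Fin.succ_ne_zero, if_false, if_true, Finset.sum_const, Finset.card_univ,
      Fintype.card_fin, Fin.succ_zero_eq_one, zero_add, nsmul_eq_mul,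
      zero_ne_one]
    push_cast
    ring
  have hs : √(staticCoeff n κ f g x 1) ≠ 0 := (Real.sqrt_pos.2 hpos).ne'
  have hD : ((n + 3 : ℕ) : ℝ) - 1 = n + 2 := by push_cast; ring
  have hn : (n : ℝ) + 2 ≠ 0 := by positivity
  rw [hsum, hD] at key
  constructor
  · intro h
    -- The time-time component is enough: it gives `(n + 1)(f'/f - 2/r) = 0`.
    have h0 := h 0 0
    rw [key, if_pos ⟨rfl, by simp⟩, if_pos rfl] at h0
    have h0' := (mul_eq_zero.1 h0).resolve_left
      (div_ne_zero (hne.self_of_nhds 0) (mul_ne_zero two_ne_zero hs))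
    rw [sub_eq_zero, one_div, eq_inv_mul_iff_mul_eq₀ hn] at h0'
    have : ((n : ℝ) + 1) * (deriv f (x 1) / f (x 1) - 2 / x 1) = 0 := by linear_combination h0'
    exact sub_eq_zero.1 ((mul_eq_zero.1 this).resolve_left (by positivity))
  · intro h a b
    rw [key, h]
    have : (2 / x 1) - 1 / ((n : ℝ) + 2) * (2 / x 1 + (n + 1) * (2 / x 1)) = 0 := by
      rw [sub_eq_zero, one_div, eq_inv_mul_iff_mul_eq₀ hn]
      ring
    rw [ite_self, this, mul_zero, ite_self]

end

end Static

/-! ### Local existence of geodesics for `C²` diagonal metrics. -/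

section Existence

variable {D : ℕ} {q : Coord D → Fin D → ℝ}

/-- The acceleration contains first derivatives of `q`, so `C²` coefficients give the `C¹` vector
field that Picard-Lindelöf asks for. -/
lemma contDiffAt_diagAccel (hq : ∀ a, ContDiff ℝ 2 fun y => q y a) {z : Coord D × Coord D}
    (hz : ∀ a, q z.1 a ≠ 0) :
    ContDiffAt ℝ 1 (fun z : Coord D × Coord D => diagAccel q z.1 z.2) z := by
  have h1 : ∀ a b, ContDiffAt ℝ 1 (fun z : Coord D × Coord D => pd a (fun y => q y b) z.1) z :=
    fun a b => (contDiffAt_pd (m := 1) (hq b).contDiffAt (by norm_num) a).comp z contDiffAt_fst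
  have h2 : ∀ b, ContDiffAt ℝ 1 (fun z : Coord D × Coord D => z.2 b) z := fun b =>
    contDiffAt_pi.1 contDiffAt_snd b
  refine contDiffAt_pi.2 fun c => ?_
  have h3 : ContDiffAt ℝ 1 (fun z : Coord D × Coord D => q z.1 c) z :=
    ((hq c).of_le (by norm_num)).contDiffAt.comp z contDiffAt_fst
  exact (h3.inv (hz c)).mul ((contDiffAt_const.mul
    (ContDiffAt.sum fun b _ => (h1 c b).mul ((h2 b).pow 2))).sub
      (ContDiffAt.sum fun b _ => ((h1 b c).mul (h2 b)).mul (h2 c)))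

lemma contDiffOn_two_of_hasDerivAt {x u v : ℝ → Coord D} {s : Set ℝ} (hs : IsOpen s)
    (hx : ∀ t ∈ s, HasDerivAt x (u t) t) (hu : ∀ t ∈ s, HasDerivAt u (v t) t)
    (hv : ContinuousOn v s) : ContDiffOn ℝ 2 x s := by
  have h1 : ContDiffOn ℝ 1 u s := by
    rw [show (1 : WithTop ℕ∞) = 0 + 1 by norm_num, contDiffOn_succ_iff_deriv_of_isOpen hs]
    refine ⟨fun t ht => (hu t ht).differentiableAt.differentiableWithinAt, by simp, ?_⟩
    exact contDiffOn_zero.2 (hv.congr fun t ht => (hu t ht).deriv)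
  rw [show (2 : WithTop ℕ∞) = 1 + 1 by norm_num, contDiffOn_succ_iff_deriv_of_isOpen hs]
  refine ⟨fun t ht => (hx t ht).differentiableAt.differentiableWithinAt, by simp, ?_⟩
  exact h1.congr fun t ht => (hx t ht).deriv

/-- Local existence of geodesics of a diagonal metric. -/
lemma exists_diag_geodesic (hq : ∀ a, ContDiff ℝ 2 fun y => q y a) {x₀ : Coord D}
    (hx₀ : ∀ a, q x₀ a ≠ 0) (u₀ : Coord D) {W : Set (Coord D)} (hW : W ∈ 𝓝 x₀) :
    ∃ ε > 0, ∃ x u : ℝ → Coord D, x 0 = x₀ ∧ u 0 = u₀ ∧ ContDiffOn ℝ 2 x (Set.Ioo (-ε) ε) ∧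
      ∀ t ∈ Set.Ioo (-ε) ε, x t ∈ W ∧ (∀ a, q (x t) a ≠ 0) ∧ HasDerivAt x (u t) t ∧
        HasDerivAt u (diagAccel q (x t) (u t)) t := by
  -- The geodesic equation as a first-order system for position and velocity; the interval is shrunk
  -- afterwards to keep the position in `W` and the metric nondegenerate.
  have hV : ContDiffAt ℝ 1 (fun z : Coord D × Coord D => (z.2, diagAccel q z.1 z.2)) (x₀, u₀) :=
    contDiffAt_snd.prodMk (contDiffAt_diagAccel hq hx₀)
  obtain ⟨z, hz0, δ, hδ, hz⟩ :=
    hV.exists_forall_mem_closedBall_exists_eq_forall_mem_Ioo_hasDerivAt₀ 0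
  rw [zero_sub, zero_add] at hz
  have h1 : ∀ t ∈ Set.Ioo (-δ) δ, HasDerivAt (fun s => (z s).1) (z t).2 t := fun t ht =>
    (hz t ht).fst
  have h2 : ∀ t ∈ Set.Ioo (-δ) δ,
      HasDerivAt (fun s => (z s).2) (diagAccel q (z t).1 (z t).2) t := fun t ht => (hz t ht).snd
  have hne : ∀ᶠ y in 𝓝 x₀, ∀ a, q y a ≠ 0 := by
    rw [eventually_all]
    exact fun a => (hq a).continuous.continuousAt.eventually_ne (hx₀ a)
  have h0 : (0 : ℝ) ∈ Set.Ioo (-δ) δ := ⟨neg_lt_zero.2 hδ, hδ⟩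
  have hc : Tendsto (fun s => (z s).1) (𝓝 0) (𝓝 x₀) := by
    have := (h1 0 h0).continuousAt.tendsto
    rwa [hz0] at this
  obtain ⟨η, hη, hball⟩ := Metric.eventually_nhds_iff_ball.1
    ((hc.eventually hne).and (hc.eventually_mem hW))
  have hm : ∀ t ∈ Set.Ioo (-min δ η) (min δ η), t ∈ Set.Ioo (-δ) δ ∧ t ∈ Metric.ball (0 : ℝ) η := by
    intro t ht
    rw [Set.mem_Ioo, ← abs_lt, lt_min_iff] at ht
    exact ⟨abs_lt.1 ht.1, by simpa using ht.2⟩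
  refine ⟨min δ η, lt_min hδ hη, fun s => (z s).1, fun s => (z s).2, congrArg Prod.fst hz0,
    congrArg Prod.snd hz0, ?_, fun t ht => ⟨(hball t (hm t ht).2).2, (hball t (hm t ht).2).1, h1 t (hm t ht).1,
      h2 t (hm t ht).1⟩⟩
  refine contDiffOn_two_of_hasDerivAt isOpen_Ioo (fun t ht => h1 t (hm t ht).1)
    (fun t ht => h2 t (hm t ht).1) fun t ht => ContinuousAt.continuousWithinAt ?_
  exact ContinuousAt.comp (f := z)
    (g := fun z : Coord D × Coord D => diagAccel q z.1 z.2)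
    (contDiffAt_diagAccel hq (hball t (hm t ht).2).1).continuousAt (hz t (hm t ht).1).continuousAt

end Existence

/-! ### Freezing the radius, and null geodesics inside `r = ρ`. -/

section Frozen

variable {n : ℕ} {κ : SpatialSymmetry} {J : Set ℝ} {f g : ℝ → ℝ} {ρ : ℝ} {x : Coord (n + 3)}

variable (n κ f g ρ) in
/-- The metric coefficients with the radius frozen at the value `ρ`. -/
def frozenCoeff (x : Coord (n + 3)) (a : Fin (n + 3)) : ℝ :=
  staticCoeff n κ f g (Function.update x 1 ρ) a

lemma update_one_self (hx : x 1 = ρ) : Function.update x 1 ρ = x := by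
  rw [← hx, Function.update_eq_self]

lemma frozenCoeff_eq (hx : x 1 = ρ) : frozenCoeff n κ f g ρ x = staticCoeff n κ f g x := by
  ext a
  rw [frozenCoeff, update_one_self hx]

/-- Here `f` and `g` enter only through the constants `f ρ` and `g ρ`, so their low regularity is
harmless. -/
lemma contDiff_frozenCoeff (a : Fin (n + 3)) :
    ContDiff ℝ 2 fun x => frozenCoeff n κ f g ρ x a := by
  by_cases h0 : a = 0
  · subst h0
    simpa only [frozenCoeff, staticCoeff_zero, Function.update_self] using contDiff_const
  by_cases h1 : a = 1
  · subst h1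
    simpa only [frozenCoeff, staticCoeff_one, Function.update_self] using contDiff_const
  simp only [frozenCoeff, staticCoeff_of_ne h0 h1, Function.update_self, angularCoeff_update]
  exact contDiff_const.mul (mod_cast contDiff_infty.1 (contDiff_angularCoeff a) 2)

lemma pd_frozenCoeff_radial (a : Fin (n + 3)) :
    pd 1 (fun y => frozenCoeff n κ f g ρ y a) x = 0 := by
  refine (hasDerivAt_update_pd ((contDiff_frozenCoeff a).differentiable (by norm_num) x) 1).unique ?_
  simp only [frozenCoeff, Function.update_idem]
  exact hasDerivAt_const _ _

lemma pd_frozenCoeff_one (c : Fin (n + 3)) :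
    pd c (fun y => frozenCoeff n κ f g ρ y 1) x = 0 := by
  simp only [frozenCoeff, staticCoeff_one, Function.update_self, pd_const]

/-- A coordinate line in a direction other than `r` stays in the slice `r = ρ`, where the two
families of coefficients coincide. -/
lemma pd_frozenCoeff (hJ : IsOpen J) (hf : ContDiffOn ℝ 1 f J) (hg : ContDiffOn ℝ 1 g J)
    (hxJ : x 1 ∈ J) (hx : x 1 = ρ) {c : Fin (n + 3)} (hc : c ≠ 1) (a : Fin (n + 3)) :
    pd c (fun y => frozenCoeff n κ f g ρ y a) x = pd c (fun y => staticCoeff n κ f g y a) x := by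
  refine (hasDerivAt_update_pd ((contDiff_frozenCoeff a).differentiable (by norm_num) x) c).unique ?_
  have := hasDerivAt_update_pd (differentiableAt_staticCoeff (κ := κ) hJ hf hg hxJ a) c
  have e : (fun s => frozenCoeff n κ f g ρ (Function.update x c s) a) =
      fun s => staticCoeff n κ f g (Function.update x c s) a := by
    ext s
    rw [frozenCoeff_eq]
    rw [Function.update_of_ne hc.symm, hx]
  rwa [e]

lemma diagAccel_frozenCoeff_radial (u : Coord (n + 3)) :
    diagAccel (frozenCoeff n κ f g ρ) x u 1 = 0 := by
  simp [diagAccel, pd_frozenCoeff_radial, pd_frozenCoeff_one]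

/-- In a component `c ≠ 1`, the only radial derivative is multiplied by `u 1 = 0`, so freezing
changes nothing. -/
lemma diagAccel_frozenCoeff (hJ : IsOpen J) (hf : ContDiffOn ℝ 1 f J) (hg : ContDiffOn ℝ 1 g J)
    (hxJ : x 1 ∈ J) (hx : x 1 = ρ) {u : Coord (n + 3)} (hu : u 1 = 0) {c : Fin (n + 3)}
    (hc : c ≠ 1) :
    diagAccel (frozenCoeff n κ f g ρ) x u c = diagAccel (staticCoeff n κ f g) x u c := by
  have e1 : ∑ b, pd b (fun y => frozenCoeff n κ f g ρ y c) x * u b * u c =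
      ∑ b, pd b (fun y => staticCoeff n κ f g y c) x * u b * u c := by
    refine Finset.sum_congr rfl fun b _ => ?_
    by_cases hb : b = 1
    · simp [hb, hu]
    · rw [pd_frozenCoeff hJ hf hg hxJ hx hb]
  simp only [diagAccel, frozenCoeff_eq hx, e1, pd_frozenCoeff hJ hf hg hxJ hx hc]

/-- If `(f / r²)' = 0` at `ρ`, null vectors tangent to `r = ρ` are initial velocities of null
geodesics in `r = ρ`. -/
lemma exists_null_geodesic_static (hJ : IsOpen J) (hJpos : ∀ r ∈ J, 0 < r)
    (hf : ContDiffOn ℝ 1 f J) (hg : ContDiffOn ℝ 1 g J) (hfpos : ∀ r ∈ J, 0 < f r)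
    (hgpos : ∀ r ∈ J, 0 < g r) (hρ : deriv f ρ / f ρ = 2 / ρ) {x₀ u₀ : Coord (n + 3)}
    (hx₀ : x₀ ∈ coordRange n κ J) (hx₀ρ : x₀ 1 = ρ) (hu₀ : u₀ 1 = 0)
    (hnull : ∑ a, staticCoeff n κ f g x₀ a * u₀ a ^ 2 = 0) {W : Set (Coord (n + 3))}
    (hW : W ∈ 𝓝 x₀) :
    ∃ ε > 0, ∃ x u : ℝ → Coord (n + 3), x 0 = x₀ ∧ u 0 = u₀ ∧
      ContDiffOn ℝ 2 x (Set.Ioo (-ε) ε) ∧ ∀ t ∈ Set.Ioo (-ε) ε, x t ∈ W ∧ x t 1 = ρ ∧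
        HasDerivAt x (u t) t ∧ geodesicOp (diagMetric (staticCoeff n κ f g)) x t = 0 ∧
        ∑ a, staticCoeff n κ f g (x t) a * u t a ^ 2 = 0 := by
  have hne : ∀ a, frozenCoeff n κ f g ρ x₀ a ≠ 0 := by
    rw [frozenCoeff_eq hx₀ρ]
    exact staticCoeff_ne_zero hJpos hfpos hgpos hx₀
  obtain ⟨ε, hε, x, u, hx0, hu0, hC, H⟩ := exists_diag_geodesic contDiff_frozenCoeff hne u₀
    (inter_mem hW ((isOpen_coordRange hJ).mem_nhds hx₀))
  have h0 : (0 : ℝ) ∈ Set.Ioo (-ε) ε := ⟨neg_lt_zero.2 hε, hε⟩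
  have hconst : ∀ {w : ℝ → ℝ}, (∀ t ∈ Set.Ioo (-ε) ε, HasDerivAt w 0 t) →
      ∀ t ∈ Set.Ioo (-ε) ε, w t = w 0 := fun hw t ht =>
    isOpen_Ioo.is_const_of_deriv_eq_zero isPreconnected_Ioo
      (fun s hs => (hw s hs).differentiableAt.differentiableWithinAt)
      (fun s hs => (hw s hs).deriv) ht h0
  -- The frozen metric has no radial acceleration, so the radial velocity keeps its initial value
  -- zero and the radius stays at `ρ`.
  have hu1 : ∀ t ∈ Set.Ioo (-ε) ε, u t 1 = 0 := by
    intro t ht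
    rw [hconst (w := fun t => u t 1) (fun s hs => ?_) t ht, hu0, hu₀]
    exact (hasDerivAt_pi.1 (H s hs).2.2.2 1).congr_deriv (diagAccel_frozenCoeff_radial _)
  have hx1 : ∀ t ∈ Set.Ioo (-ε) ε, x t 1 = ρ := by
    intro t ht
    rw [hconst (w := fun t => x t 1) (fun s hs => ?_) t ht, hx0, hx₀ρ]
    exact (hasDerivAt_pi.1 (H s hs).2.2.1 1).congr_deriv (hu1 s hs)
  -- Energy is conserved for the frozen metric; on the slice it is also the energy of the original
  -- one.
  have henergy : ∀ t ∈ Set.Ioo (-ε) ε, ∑ a, staticCoeff n κ f g (x t) a * u t a ^ 2 = 0 := by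
    intro t ht
    have e := hconst (fun s hs => hasDerivAt_diag_energy (H s hs).2.1
      (fun a => (contDiff_frozenCoeff a).differentiable (by norm_num) _) (H s hs).2.2.1
      (H s hs).2.2.2) t ht
    rw [frozenCoeff_eq (hx1 t ht), frozenCoeff_eq (hx1 0 h0), hx0, hu0, hnull] at e
    exact e
  refine ⟨ε, hε, x, u, hx0, hu0, hC, fun t ht => ?_⟩
  obtain ⟨hW', -, hxd, hud⟩ := H t ht
  refine ⟨hW'.1, hx1 t ht, hxd, ?_, henergy t ht⟩
  have hd : ∀ s ∈ Set.Ioo (-ε) ε, ∀ a, deriv (fun r => x r a) s = u s a := fun s hs a =>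
    (hasDerivAt_pi.1 (H s hs).2.2.1 a).deriv
  have hdd : ∀ c, deriv (deriv fun r => x r c) t = diagAccel (frozenCoeff n κ f g ρ) (x t) (u t) c := by
    intro c
    have ev : (deriv fun r => x r c) =ᶠ[𝓝 t] fun s => u s c := by
      filter_upwards [isOpen_Ioo.mem_nhds ht] with s hs using hd s hs c
    rw [ev.deriv_eq]
    exact (hasDerivAt_pi.1 hud c).deriv
  ext c
  rw [geodesicOp_diagMetric (staticCoeff_ne_zero hJpos hfpos hgpos hW'.2), hdd]
  simp only [hd t ht]
  rw [Pi.zero_apply, sub_eq_zero]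
  by_cases hc : c = 1
  · subst hc
    rw [diagAccel_frozenCoeff_radial, diagAccel_staticCoeff_radial hJ hJpos hf hg hfpos hW'.2
      (hu1 t ht) (henergy t ht), hx1 t ht, hρ]
    simp
  · exact diagAccel_frozenCoeff hJ hf hg hW'.2.1 (hx1 t ht) (hu1 t ht) hc

end Frozen

/-! ### Tangent vectors, metric components and transition maps in smooth charts. -/

section Manifold

variable {D : ℕ} {M : Type*} [TopologicalSpace M] [ChartedSpace (Coord D) M]
  {e e₀ : OpenPartialHomeomorph M (Coord D)} {p : M}

lemma mdifferentiableAt_smoothChart (he : e ∈ smoothCharts D M) (hp : p ∈ e.source) :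
    MDifferentiableAt 𝓘(ℝ, Coord D) 𝓘(ℝ, Coord D) e p :=
  (contMDiffAt_of_mem_maximalAtlas he hp).mdifferentiableAt (by simp)

lemma mdifferentiableAt_smoothChart_symm (he : e ∈ smoothCharts D M) {x : Coord D}
    (hx : x ∈ e.target) : MDifferentiableAt 𝓘(ℝ, Coord D) 𝓘(ℝ, Coord D) e.symm x :=
  (contMDiffAt_symm_of_mem_maximalAtlas he hx).mdifferentiableAt (by simp)

/-- The components of a tangent vector in a chart. -/
def components (e : OpenPartialHomeomorph M (Coord D)) (p : M)
    (v : TangentSpace 𝓘(ℝ, Coord D) p) : Coord D :=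
  mfderiv 𝓘(ℝ, Coord D) 𝓘(ℝ, Coord D) e p v

/-- The tangent vector at `p` with given components in a chart. -/
def ofComponents (e : OpenPartialHomeomorph M (Coord D)) (p : M) (w : Coord D) :
    TangentSpace 𝓘(ℝ, Coord D) p :=
  (mfderiv 𝓘(ℝ, Coord D) 𝓘(ℝ, Coord D) e.symm (e p) : Coord D →L[ℝ] Coord D) w

lemma mdifferentiable_smoothChart (he : e ∈ smoothCharts D M) :
    e.MDifferentiable 𝓘(ℝ, Coord D) 𝓘(ℝ, Coord D) :=
  ⟨(contMDiffOn_of_mem_maximalAtlas he).mdifferentiableOn (by simp),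
    (contMDiffOn_symm_of_mem_maximalAtlas he).mdifferentiableOn (by simp)⟩

lemma ofComponents_components (he : e ∈ smoothCharts D M) (hp : p ∈ e.source)
    (v : TangentSpace 𝓘(ℝ, Coord D) p) : ofComponents e p (components e p v) = v :=
  congrArg (fun L : Coord D →L[ℝ] Coord D => L v)
    ((mdifferentiable_smoothChart he).symm_comp_deriv hp)

lemma components_ofComponents (he : e ∈ smoothCharts D M) (hp : p ∈ e.source) (w : Coord D) :
    components e p (ofComponents e p w) = w := by
  have h := (mdifferentiable_smoothChart he).comp_symm_deriv (e.map_source hp)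
  rw [e.left_inv hp] at h
  exact congrArg (fun L : Coord D →L[ℝ] Coord D => L w) h

lemma tangentBundle_ext (he : e ∈ smoothCharts D M) {p' : M} (hp : p ∈ e.source) (h : p' = p)
    {v' : TangentSpace 𝓘(ℝ, Coord D) p'} {v : TangentSpace 𝓘(ℝ, Coord D) p}
    (hv : components e p' v' = components e p v) :
    (⟨p', v'⟩ : TangentBundle 𝓘(ℝ, Coord D) M) = ⟨p, v⟩ := by
  subst h
  rw [← ofComponents_components he hp v', hv, ofComponents_components he hp]

lemma bilin_apply_eq_sum (B : Coord D →L[ℝ] Coord D →L[ℝ] ℝ) (v w : Coord D) :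
    B v w = ∑ a, ∑ b, B (Pi.single a 1) (Pi.single b 1) * v a * w b := by
  conv_lhs => rw [pi_eq_sum_univ' v, pi_eq_sum_univ' w]
  simp only [map_sum, map_smul, sum_apply, smul_apply, smul_eq_mul, Finset.mul_sum]
  rw [Finset.sum_comm]
  exact Finset.sum_congr rfl fun a _ => Finset.sum_congr rfl fun b _ => by ring

lemma metric_apply_eq_sum (g : BilinField D M) (he : e ∈ smoothCharts D M) (hp : p ∈ e.source)
    (v w : TangentSpace 𝓘(ℝ, Coord D) p) :
    g p v w = ∑ a, ∑ b, metricInChart g e (e p) a b * components e p v a * components e p w b := by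
  -- All tangent spaces are modelled on `Coord D`, so the metric becomes a map into a fixed space,
  -- where `e.symm (e p)` may be replaced by `p`.
  let B : M → Coord D →L[ℝ] Coord D →L[ℝ] ℝ := fun q => g q
  let L : Coord D →L[ℝ] Coord D := mfderiv 𝓘(ℝ, Coord D) 𝓘(ℝ, Coord D) e.symm (e p)
  have h1 : ∀ a b, metricInChart g e (e p) a b =
      ((B p).bilinearComp L L) (Pi.single a 1) (Pi.single b 1) := by
    intro a b
    change B (e.symm (e p)) (L (Pi.single a 1)) (L (Pi.single b 1)) = _
    rw [e.left_inv hp]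
    rfl
  simp only [h1]
  rw [← bilin_apply_eq_sum ((B p).bilinearComp L L)]
  change B p v w = B p (ofComponents e p (components e p v)) (ofComponents e p (components e p w))
  rw [ofComponents_components he hp, ofComponents_components he hp]

lemma components_velocity {γ : ℝ → M} {t : ℝ} (he : e ∈ smoothCharts D M) (hp : γ t ∈ e.source)
    (hγ : MDifferentiableAt 𝓘(ℝ, ℝ) 𝓘(ℝ, Coord D) γ t) :
    HasDerivAt (fun s => e (γ s)) (components e (γ t) (velocity D γ t)) t := by
  have h := (mdifferentiableAt_smoothChart he hp).hasMFDerivAt.comp t hγ.hasMFDerivAt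
  have key : ∀ L : ℝ →L[ℝ] Coord D, HasFDerivAt (fun s => e (γ s)) L t →
      HasDerivAt (fun s => e (γ s)) (L 1) t := fun L hL => hL.hasDerivAt
  exact key _ (hasMFDerivAt_iff_hasFDerivAt.1 h)

lemma contDiffAt_transition (he₀ : e₀ ∈ smoothCharts D M) (he : e ∈ smoothCharts D M)
    (hp₀ : p ∈ e₀.source) (hp : p ∈ e.source) : ContDiffAt ℝ ∞ (e₀ ∘ e.symm) (e p) := by
  rw [← contMDiffAt_iff_contDiffAt]
  refine ContMDiffAt.comp (I' := 𝓘(ℝ, Coord D)) (e p) ?_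
    (contMDiffAt_symm_of_mem_maximalAtlas he (e.map_source hp))
  rw [e.left_inv hp]
  exact contMDiffAt_of_mem_maximalAtlas he₀ hp₀

lemma components_transition (he₀ : e₀ ∈ smoothCharts D M) (he : e ∈ smoothCharts D M)
    (hp₀ : p ∈ e₀.source) (hp : p ∈ e.source) (w : Coord D) :
    components e₀ p (ofComponents e p w) = (jac (e₀ ∘ e.symm) (e p)).mulVec w := by
  have hd : DifferentiableAt ℝ (e₀ ∘ e.symm) (e p) :=
    (contDiffAt_transition he₀ he hp₀ hp).differentiableAt (by simp)
  have hp₀' : e.symm (e p) ∈ e₀.source := by rwa [e.left_inv hp]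
  rw [← fderiv_apply_eq_jac_mulVec hd, ← mfderiv_eq_fderiv,
    mfderiv_comp (I' := 𝓘(ℝ, Coord D)) (e p) (mdifferentiableAt_smoothChart he₀ hp₀')
      (mdifferentiableAt_smoothChart_symm he (e.map_source hp))]
  have : ∀ q, q = p → ∀ v : Coord D, (mfderiv 𝓘(ℝ, Coord D) 𝓘(ℝ, Coord D) e₀ p :
      Coord D →L[ℝ] Coord D) v = (mfderiv 𝓘(ℝ, Coord D) 𝓘(ℝ, Coord D) e₀ q :
      Coord D →L[ℝ] Coord D) v := by
    rintro q rfl v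
    rfl
  exact this _ (e.left_inv hp) _

/-- The Jacobian sends the components of a tangent vector in `e` to those in `e₀`, and both charts
determine the vector. -/
lemma isUnit_jac_transition (he₀ : e₀ ∈ smoothCharts D M) (he : e ∈ smoothCharts D M)
    (hp₀ : p ∈ e₀.source) (hp : p ∈ e.source) : IsUnit (jac (e₀ ∘ e.symm) (e p)).det := by
  refine (Matrix.isUnit_iff_isUnit_det _).1 (Matrix.mulVec_injective_iff_isUnit.1 fun v w h => ?_)
  simp only [← components_transition he₀ he hp₀ hp] at h
  have h2 := congrArg (ofComponents e₀ p) h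
  rw [ofComponents_components he₀ hp₀, ofComponents_components he₀ hp₀] at h2
  have h3 := congrArg (components e p) h2
  rwa [components_ofComponents he hp, components_ofComponents he hp] at h3

lemma metricInChart_transition (g : BilinField D M) (he₀ : e₀ ∈ smoothCharts D M)
    (he : e ∈ smoothCharts D M) (hp₀ : p ∈ e₀.source) (hp : p ∈ e.source) :
    metricInChart g e (e p) = (jac (e₀ ∘ e.symm) (e p)).transpose * metricInChart g e₀ (e₀ p)
      * jac (e₀ ∘ e.symm) (e p) := by
  ext a b
  have h1 : metricInChart g e (e p) a b =
      g p (ofComponents e p (Pi.single a 1)) (ofComponents e p (Pi.single b 1)) := by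
    let B : M → Coord D →L[ℝ] Coord D →L[ℝ] ℝ := fun q => g q
    let L : Coord D →L[ℝ] Coord D := mfderiv 𝓘(ℝ, Coord D) 𝓘(ℝ, Coord D) e.symm (e p)
    change B (e.symm (e p)) (L (Pi.single a 1)) (L (Pi.single b 1)) =
      B p (L (Pi.single a 1)) (L (Pi.single b 1))
    rw [e.left_inv hp]
  rw [h1, metric_apply_eq_sum g he₀ hp₀]
  simp only [components_transition he₀ he hp₀ hp, Matrix.mulVec_single_one, Matrix.col_apply,
    Matrix.mul_apply, Matrix.transpose_apply, Finset.sum_mul]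
  rw [Finset.sum_comm]
  exact Finset.sum_congr rfl fun i _ => Finset.sum_congr rfl fun j _ => by ring

end Manifold

/-! ### Static charts, and comparison of an arbitrary chart with a static one. -/

section StaticChart

variable {n : ℕ} {M : Type*} [TopologicalSpace M] [ChartedSpace (Coord (n + 3)) M]

/-- `e` is a chart `(t, r, χ, θ₁, …, θₙ)` with `r = R` in which `G` is the static metric. -/
structure IsStaticChart (κ : SpatialSymmetry) (J : Set ℝ) (f g : ℝ → ℝ) (G : BilinField (n + 3) M)
    (R : M → ℝ) (e : OpenPartialHomeomorph M (Coord (n + 3))) : Prop where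
  mem : e ∈ smoothCharts (n + 3) M
  mem_coordRange : ∀ q ∈ e.source, e q ∈ coordRange n κ J
  radius : ∀ q ∈ e.source, R q = e q 1
  metric : ∀ x ∈ e.target, metricInChart G e x = diagMetric (staticCoeff n κ f g) x

variable {κ : SpatialSymmetry} {J : Set ℝ} {f g : ℝ → ℝ} {G : BilinField (n + 3) M} {R : M → ℝ}
  {e e₀ : OpenPartialHomeomorph M (Coord (n + 3))} {p : M}

lemma IsStaticSpacetime.exists_isStaticChart (h : IsStaticSpacetime κ J f g G R) (p : M) :
    ∃ e, IsStaticChart κ J f g G R e ∧ p ∈ e.source := by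
  obtain ⟨e, he, hp, h1, h2⟩ := h p
  exact ⟨e, ⟨he, fun q hq => (h1 q hq).1, fun q hq => (h1 q hq).2, h2⟩, hp⟩

namespace IsStaticChart

lemma radius_eventuallyEq (h : IsStaticChart κ J f g G R e₀) (hp : p ∈ e₀.source) :
    R =ᶠ[𝓝 p] fun q => e₀ q 1 := by
  filter_upwards [e₀.open_source.mem_nhds hp] with q hq using h.radius q hq

lemma isTangent_iff (h : IsStaticChart κ J f g G R e₀) (hp : p ∈ e₀.source)
    (v : TangentSpace 𝓘(ℝ, Coord (n + 3)) p) : IsTangent R p v ↔ components e₀ p v 1 = 0 := by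
  have h1 : HasMFDerivAt 𝓘(ℝ, Coord (n + 3)) 𝓘(ℝ, ℝ) (fun x : Coord (n + 3) => x 1) (e₀ p)
      (ContinuousLinearMap.proj (R := ℝ) (φ := fun _ : Fin (n + 3) => ℝ) 1) :=
    (ContinuousLinearMap.proj (R := ℝ) (φ := fun _ : Fin (n + 3) => ℝ) 1).hasFDerivAt.hasMFDerivAt
  have h2 := h1.comp p (mdifferentiableAt_smoothChart h.mem hp).hasMFDerivAt
  have h3 := h2.congr_of_eventuallyEq (h.radius_eventuallyEq hp)
  rw [IsTangent, h3.mfderiv]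
  rfl

lemma contMDiffAt_radius (h : IsStaticChart κ J f g G R e₀) (hp : p ∈ e₀.source) :
    ContMDiffAt 𝓘(ℝ, Coord (n + 3)) 𝓘(ℝ, ℝ) ∞ R p := by
  refine ContMDiffAt.congr_of_eventuallyEq ?_ (h.radius_eventuallyEq hp)
  exact ContMDiffAt.comp p (g := fun x : Coord (n + 3) => x 1)
    (contDiff_apply ℝ ℝ (1 : Fin (n + 3))).contDiffAt.contMDiffAt
    (contMDiffAt_of_mem_maximalAtlas h.mem hp)

lemma metric_apply (h : IsStaticChart κ J f g G R e₀) (hp : p ∈ e₀.source)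
    (v : TangentSpace 𝓘(ℝ, Coord (n + 3)) p) :
    G p v v = ∑ a, staticCoeff n κ f g (e₀ p) a * components e₀ p v a ^ 2 := by
  rw [metric_apply_eq_sum G h.mem hp, h.metric _ (e₀.map_source hp)]
  refine Finset.sum_congr rfl fun a _ => ?_
  rw [Finset.sum_eq_single a]
  · rw [diagMetric, Matrix.diagonal_apply_eq]
    ring
  · intro b _ hb
    simp [diagMetric, Matrix.diagonal_apply_ne _ hb.symm]
  · simp

/-- The bridge to arbitrary charts. No regularity is assumed of the field `G`; all that is needed
comes from the explicit coefficients and the smooth transition map. -/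
lemma isPullbackAt (h : IsStaticChart κ J f g G R e₀) (hJ : IsOpen J) (hJpos : ∀ r ∈ J, 0 < r)
    (hf : ContDiffOn ℝ 1 f J) (hg : ContDiffOn ℝ 1 g J) (hfpos : ∀ r ∈ J, 0 < f r)
    (hgpos : ∀ r ∈ J, 0 < g r) (he : e ∈ smoothCharts (n + 3) M) (hp₀ : p ∈ e₀.source)
    (hp : p ∈ e.source) :
    IsPullbackAt (e₀ ∘ e.symm) (diagMetric (staticCoeff n κ f g)) (metricInChart G e) (e p) := by
  -- Coordinates near `e p` come from points in both chart domains, so the pointwise transition laws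
  -- hold on a neighbourhood.
  have hev : ∀ᶠ z in 𝓝 (e p), ∃ q, q ∈ e₀.source ∧ q ∈ e.source ∧ e q = z := by
    have : e₀.source ∈ 𝓝 (e.symm (e p)) := by
      rw [e.left_inv hp]
      exact e₀.open_source.mem_nhds hp₀
    filter_upwards [e.open_target.mem_nhds (e.map_source hp),
      (e.continuousAt_symm (e.map_source hp)).preimage_mem_nhds this] with z hz hz'
    exact ⟨e.symm z, hz', e.map_target hz, e.right_inv hz⟩
  have hφ : ∀ q ∈ e.source, (e₀ ∘ e.symm) (e q) = e₀ q := fun q hq => by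
    rw [Function.comp_apply, e.left_inv hq]
  refine ⟨(contDiffAt_transition h.mem he hp₀ hp).of_le (mod_cast ENat.LEInfty.out), ?_, ?_, ?_, ?_, ?_⟩
  · filter_upwards [hev] with z hz
    obtain ⟨q, hq₀, hq, rfl⟩ := hz
    rw [metricInChart_transition G h.mem he hq₀ hq, h.metric _ (e₀.map_source hq₀), hφ q hq]
  · filter_upwards [hev] with z hz
    obtain ⟨q, hq₀, hq, rfl⟩ := hz
    exact isUnit_jac_transition h.mem he hq₀ hq
  · filter_upwards [hev] with z hz
    obtain ⟨q, hq₀, hq, rfl⟩ := hz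
    rw [hφ q hq, diagMetric, Matrix.det_diagonal, isUnit_iff_ne_zero, Finset.prod_ne_zero_iff]
    exact fun a _ => staticCoeff_ne_zero hJpos hfpos hgpos (h.mem_coordRange q hq₀) a
  · intro i j
    rw [hφ p hp]
    by_cases hij : i = j
    · subst hij
      simp only [diagMetric, Matrix.diagonal_apply_eq]
      exact differentiableAt_staticCoeff hJ hf hg (h.mem_coordRange p hp₀).1 i
    · simp only [diagMetric, Matrix.diagonal_apply_ne _ hij]
      exact differentiableAt_const _
  · rw [diagMetric, Matrix.diagonal_transpose]

lemma traceFreePart_eq_zero_iff (h : IsStaticChart κ J f g G R e₀) (hJ : IsOpen J)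
    (hJpos : ∀ r ∈ J, 0 < r) (hf : ContDiffOn ℝ 1 f J) (hg : ContDiffOn ℝ 1 g J)
    (hfpos : ∀ r ∈ J, 0 < f r) (hgpos : ∀ r ∈ J, 0 < g r) (he : e ∈ smoothCharts (n + 3) M)
    (hp₀ : p ∈ e₀.source) (hp : p ∈ e.source) :
    (∀ a b, traceFreePart (metricInChart G e) (R ∘ e.symm) (e p) a b = 0) ↔
      deriv f (R p) / f (R p) = 2 / R p := by
  have hpull := h.isPullbackAt hJ hJpos hf hg hfpos hgpos he hp₀ hp
  have hφp : (e₀ ∘ e.symm) (e p) = e₀ p := by rw [Function.comp_apply, e.left_inv hp]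
  have hx := h.mem_coordRange p hp₀
  have hR : R ∘ e.symm =ᶠ[𝓝 (e p)] fun z => (fun y : Coord (n + 3) => y 1) ((e₀ ∘ e.symm) z) := by
    have := h.radius_eventuallyEq hp₀
    rw [← e.left_inv hp] at this
    exact (e.continuousAt_symm (e.map_source hp)).eventually this
  rw [hpull.traceFreePart_eq_zero_iff (F := fun y => y 1)
    (Eventually.of_forall fun x => differentiableAt_apply 1 x) hR, hφp,
    traceFreePart_static_eq_zero_iff hJ hJpos hf hg hfpos hgpos hx, h.radius p hp₀]
  intro i
  rw [hφp]
  refine differentiableAt_normalCovector_diagMetric ?_ ?_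
    (differentiableAt_staticCoeff hJ hf hg hx.1 1) i
  · filter_upwards [(isOpen_coordRange hJ).mem_nhds hx] with z hz a
    exact staticCoeff_ne_zero hJpos hfpos hgpos hz a
  · rw [staticCoeff_one]
    exact hgpos _ hx.1

end IsStaticChart

end StaticChart

/-! ### The two characterisations. -/

section Main

variable {n : ℕ} {M : Type*} [TopologicalSpace M] [ChartedSpace (Coord (n + 3)) M]
  {κ : SpatialSymmetry} {J : Set ℝ} {f g : ℝ → ℝ} {G : BilinField (n + 3) M} {R : M → ℝ} {ρ : ℝ}

/-- The trace-free part depends only on `r`, so one point of the surface decides; without a point,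
umbilicity would be vacuous. -/
lemma isTotallyUmbilic_iff (hJ : IsOpen J) (hJpos : ∀ r ∈ J, 0 < r) (hf : ContDiffOn ℝ 1 f J)
    (hg : ContDiffOn ℝ 1 g J) (hfpos : ∀ r ∈ J, 0 < f r) (hgpos : ∀ r ∈ J, 0 < g r)
    (hM : IsStaticSpacetime κ J f g G R) (hρ : ∃ p : M, R p = ρ) :
    IsTotallyUmbilic G R ρ ↔ deriv f ρ / f ρ = 2 / ρ := by
  constructor
  · intro h
    obtain ⟨p, hp⟩ := hρ
    obtain ⟨e₀, he₀, hp₀⟩ := hM.exists_isStaticChart p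
    rw [← hp, ← he₀.traceFreePart_eq_zero_iff hJ hJpos hf hg hfpos hgpos he₀.mem hp₀ hp₀]
    exact h p hp e₀ he₀.mem hp₀
  · intro h p hp e he hpe
    obtain ⟨e₀, he₀, hp₀⟩ := hM.exists_isStaticChart p
    rw [← hp, ← he₀.traceFreePart_eq_zero_iff hJ hJpos hf hg hfpos hgpos he hp₀ hpe] at h
    exact h

namespace IsStaticChart

variable {e₀ : OpenPartialHomeomorph M (Coord (n + 3))} {p : M}

/-- The radial component of the equation of a null geodesic through `p` which stays in `r = ρ`. -/
lemma radial_eq_of_null_geodesic (h : IsStaticChart κ J f g G R e₀) (hJ : IsOpen J)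
    (hJpos : ∀ r ∈ J, 0 < r) (hf : ContDiffOn ℝ 1 f J) (hg : ContDiffOn ℝ 1 g J)
    (hfpos : ∀ r ∈ J, 0 < f r) (hgpos : ∀ r ∈ J, 0 < g r) {γ : ℝ → M} {ε : ℝ} (hε : 0 < ε)
    (hγ : IsNullGeodesicOn G γ (Set.Ioo (-ε) ε)) (hγR : ∀ τ ∈ Set.Ioo (-ε) ε, R (γ τ) = ρ)
    (h0 : γ 0 ∈ e₀.source) (ht : components e₀ (γ 0) (velocity (n + 3) γ 0) 0 ≠ 0) :
    deriv f ρ / f ρ = 2 / ρ := by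
  have m0 : (0 : ℝ) ∈ Set.Ioo (-ε) ε := ⟨neg_lt_zero.2 hε, hε⟩
  have hγ0 : ContMDiffAt 𝓘(ℝ, ℝ) 𝓘(ℝ, Coord (n + 3)) 2 γ 0 :=
    hγ.contMDiffOn.contMDiffAt (isOpen_Ioo.mem_nhds m0)
  set x : ℝ → Coord (n + 3) := fun t => e₀ (γ t) with hx
  have hxC : ContDiffAt ℝ 2 x 0 := contMDiffAt_iff_contDiffAt.1 (ContMDiffAt.comp 0
    ((contMDiffAt_of_mem_maximalAtlas h.mem h0).of_le (mod_cast ENat.LEInfty.out)) hγ0)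
  have hvel := components_velocity h.mem h0 (hγ0.mdifferentiableAt (by norm_num))
  set u := components e₀ (γ 0) (velocity (n + 3) γ 0) with hu
  have hud : ∀ a, deriv (fun t => x t a) 0 = u a := fun a => (hasDerivAt_pi.1 hvel a).deriv
  have hnull : ∑ a, staticCoeff n κ f g (x 0) a * u a ^ 2 = 0 := by
    rw [← h.metric_apply h0]
    exact hγ.null 0 m0
  have hev : (fun t => x t 1) =ᶠ[𝓝 0] fun _ => ρ := by
    filter_upwards [isOpen_Ioo.mem_nhds m0,
      hγ0.continuousAt.preimage_mem_nhds (e₀.open_source.mem_nhds h0)] with t ht ht'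
    rw [hx, ← hγR t ht, h.radius _ ht']
  have hx0 : e₀ (γ 0) 1 = ρ := hev.self_of_nhds
  have hu1 : u 1 = 0 := by rw [← hud, hev.deriv_eq, deriv_const]
  have hdd : deriv (deriv fun t => x t 1) 0 = 0 := by
    rw [hev.deriv.deriv_eq]
    simp
  have hmem := h.mem_coordRange _ h0
  -- The metric in the chart `e₀` is diagonal only on its target. The transition of `e₀` with itself
  -- exchanges it for the globally defined `diagMetric`.
  have hgeo : geodesicOp (diagMetric (staticCoeff n κ f g)) x 0 = 0 := by
    have hx' : x =ᶠ[𝓝 0] fun t => (e₀ ∘ e₀.symm) (x t) := by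
      filter_upwards [hγ0.continuousAt.preimage_mem_nhds (e₀.open_source.mem_nhds h0)] with t ht'
      rw [hx, Function.comp_apply, e₀.left_inv ht']
    refine ((h.isPullbackAt hJ hJpos hf hg hfpos hgpos h.mem h0 h0).geodesicOp_eq_zero_iff
      hxC hx').2 (funext fun c => ?_)
    exact hγ.geodesic_equation e₀ h.mem 0 m0 h0 c
  have h1 := congrFun hgeo 1
  rw [geodesicOp_diagMetric (staticCoeff_ne_zero hJpos hfpos hgpos hmem), hdd,
    funext hud, diagAccel_staticCoeff_radial hJ hJpos hf hg hfpos hmem hu1 hnull, hx0, zero_sub,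
    Pi.zero_apply, neg_eq_zero] at h1
  have hρJ : ρ ∈ J := hx0 ▸ hmem.1
  have hg0 := (hgpos ρ hρJ).ne'
  have hf0 := (hfpos ρ hρJ).ne'
  simp only [mul_eq_zero, inv_eq_zero, hg0, hf0, false_or, or_false, pow_eq_zero_iff, ne_eq,
    OfNat.ofNat_ne_zero, not_false_eq_true, ht, one_div] at h1
  exact (sub_eq_zero.1 h1).symm

lemma exists_null_geodesic (h : IsStaticChart κ J f g G R e₀) (hJ : IsOpen J)
    (hJpos : ∀ r ∈ J, 0 < r) (hf : ContDiffOn ℝ 1 f J) (hg : ContDiffOn ℝ 1 g J)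
    (hfpos : ∀ r ∈ J, 0 < f r) (hgpos : ∀ r ∈ J, 0 < g r) (hρ : deriv f ρ / f ρ = 2 / ρ)
    (hp₀ : p ∈ e₀.source) (hp : R p = ρ) {k : TangentSpace 𝓘(ℝ, Coord (n + 3)) p}
    (hk : IsTangent R p k) (hnull : G p k k = 0) :
    ∃ ε > 0, ∃ γ : ℝ → M, IsNullGeodesicOn G γ (Set.Ioo (-ε) ε) ∧
      (⟨γ 0, velocity (n + 3) γ 0⟩ : TangentBundle 𝓘(ℝ, Coord (n + 3)) M) = ⟨p, k⟩ ∧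
      ∀ τ ∈ Set.Ioo (-ε) ε, R (γ τ) = ρ := by
  rw [h.metric_apply hp₀] at hnull
  obtain ⟨ε, hε, x, u, hx0, hu0, hC, H⟩ := exists_null_geodesic_static hJ hJpos hf hg hfpos hgpos hρ
    (h.mem_coordRange p hp₀) ((h.radius p hp₀).symm.trans hp) ((h.isTangent_iff hp₀ k).1 hk) hnull
    (e₀.open_target.mem_nhds (e₀.map_source hp₀))
  have m0 : (0 : ℝ) ∈ Set.Ioo (-ε) ε := ⟨neg_lt_zero.2 hε, hε⟩
  set γ : ℝ → M := fun t => e₀.symm (x t) with hγdef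
  have hsrc : ∀ t ∈ Set.Ioo (-ε) ε, γ t ∈ e₀.source := fun t ht => e₀.map_target (H t ht).1
  have hex : ∀ t ∈ Set.Ioo (-ε) ε, e₀ (γ t) = x t := fun t ht => e₀.right_inv (H t ht).1
  have hγC : ContMDiffOn 𝓘(ℝ, ℝ) 𝓘(ℝ, Coord (n + 3)) 2 γ (Set.Ioo (-ε) ε) :=
    ((contMDiffOn_symm_of_mem_maximalAtlas h.mem).of_le (mod_cast ENat.LEInfty.out)).comp
      (contMDiffOn_iff_contDiffOn.2 hC) fun t ht => (H t ht).1
  have hγC' : ∀ t ∈ Set.Ioo (-ε) ε, ContMDiffAt 𝓘(ℝ, ℝ) 𝓘(ℝ, Coord (n + 3)) 2 γ t := fun t ht =>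
    hγC.contMDiffAt (isOpen_Ioo.mem_nhds ht)
  have hvel : ∀ t ∈ Set.Ioo (-ε) ε, components e₀ (γ t) (velocity (n + 3) γ t) = u t := by
    intro t ht
    have h1 := components_velocity h.mem (hsrc t ht)
      ((hγC' t ht).mdifferentiableAt (by norm_num))
    refine (h1.congr_of_eventuallyEq ?_).unique (H t ht).2.2.1
    filter_upwards [isOpen_Ioo.mem_nhds ht] with s hs using (hex s hs).symm
  refine ⟨ε, hε, γ, ⟨hγC, ?_, ?_⟩, ?_, ?_⟩
  · intro e he τ hτ hτe c
    have hy : ContDiffAt ℝ 2 (fun t => e (γ t)) τ := contMDiffAt_iff_contDiffAt.1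
      (ContMDiffAt.comp τ ((contMDiffAt_of_mem_maximalAtlas he hτe).of_le
        (mod_cast ENat.LEInfty.out)) (hγC' τ hτ))
    have hx : x =ᶠ[𝓝 τ] fun t => (e₀ ∘ e.symm) (e (γ t)) := by
      filter_upwards [isOpen_Ioo.mem_nhds hτ,
        (hγC' τ hτ).continuousAt.preimage_mem_nhds (e.open_source.mem_nhds hτe)] with t ht ht'
      rw [Function.comp_apply, e.left_inv ht', hex t ht]
    have := ((h.isPullbackAt hJ hJpos hf hg hfpos hgpos he (hsrc τ hτ) hτe).geodesicOp_eq_zero_iff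
      (y := fun t => e (γ t)) hy hx).1 (H τ hτ).2.2.2.1
    exact congrFun this c
  · intro τ hτ
    rw [h.metric_apply (hsrc τ hτ), hvel τ hτ, hex τ hτ]
    exact (H τ hτ).2.2.2.2
  · refine tangentBundle_ext h.mem hp₀ ?_ ?_
    · rw [hγdef]
      simp only [hx0, e₀.left_inv hp₀]
    · rw [hvel 0 m0, hu0]
  · intro τ hτ
    rw [h.radius _ (hsrc τ hτ), hex τ hτ]
    exact (H τ hτ).2.1

end IsStaticChart

lemma isPhotonSurface_iff (hJ : IsOpen J) (hJpos : ∀ r ∈ J, 0 < r) (hf : ContDiffOn ℝ 1 f J)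
    (hg : ContDiffOn ℝ 1 g J) (hfpos : ∀ r ∈ J, 0 < f r) (hgpos : ∀ r ∈ J, 0 < g r)
    (hM : IsStaticSpacetime κ J f g G R) (hρ : ∃ p : M, R p = ρ) :
    IsPhotonSurface G R ρ ↔ deriv f ρ / f ρ = 2 / ρ := by
  have h21 := two_ne_one_fin n
  have h20 := two_ne_zero_fin n
  have h01 : (1 : Fin (n + 3)) ≠ 0 := by simp
  constructor
  · intro h
    obtain ⟨p, hp⟩ := hρ
    obtain ⟨e₀, he₀, hp₀⟩ := hM.exists_isStaticChart p
    have hmem := he₀.mem_coordRange p hp₀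
    -- The vector `∂_t + (√f / r) ∂_χ` is tangent and null, since `-f + r² (f / r²) = 0`, and its
    -- time component is nonzero. The direction `χ` exists in every dimension `D ≥ 3`.
    set w : Coord (n + 3) := Pi.single 0 1 + Pi.single 2 (√(f (e₀ p 1)) / e₀ p 1) with hw
    have hk := components_ofComponents he₀.mem hp₀ w
    set k := ofComponents e₀ p w
    have hw0 : w 0 = 1 := by simp [hw, h20.symm]
    have hw1 : w 1 = 0 := by simp [hw, h21.symm, h01]
    have hr := (hJpos _ hmem.1).ne'
    have hnull : G p k k = 0 := by
      rw [he₀.metric_apply hp₀, hk, Finset.sum_eq_add (0 : Fin (n + 3)) 2 h20.symm]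
      · rw [hw0, staticCoeff_zero, staticCoeff_of_ne h20 h21, angularCoeff,
          if_pos (coe_two_fin n).le]
        have : w 2 = √(f (e₀ p 1)) / e₀ p 1 := by simp [hw, h20]
        rw [this, div_pow, Real.sq_sqrt (hfpos _ hmem.1).le]
        field_simp
        ring
      · rintro c - ⟨hc0, hc2⟩
        simp [hw, hc0, hc2]
      · simp
      · simp
    obtain ⟨ε, hε, γ, hγ, hγ0, hγR⟩ := h.null_geodesics p hp k
      ((he₀.isTangent_iff hp₀ k).2 (by rw [hk, hw1])) (fun h0 => by
        rw [h0] at hk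
        have : components e₀ p 0 = 0 := map_zero _
        rw [this] at hk
        rw [← hk] at hw0
        simp at hw0) hnull
    have e1 : γ 0 = p := congrArg Bundle.TotalSpace.proj hγ0
    have e2 : components e₀ (γ 0) (velocity (n + 3) γ 0) = components e₀ p k :=
      congrArg (fun z : TangentBundle 𝓘(ℝ, Coord (n + 3)) M => components e₀ z.1 z.2) hγ0
    refine he₀.radial_eq_of_null_geodesic hJ hJpos hf hg hfpos hgpos hε hγ hγR (e1 ▸ hp₀) ?_
    rw [e2, hk, hw0]
    exact one_ne_zero
  · intro h
    refine ⟨fun p hp => ?_, fun p hp => ?_, fun p hp k hk _ hnull => ?_⟩ <;>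
      obtain ⟨e₀, he₀, hp₀⟩ := hM.exists_isStaticChart p
    -- The coordinate vector `∂_r` is transversal to the surface; below, `∂_t` is tangent and
    -- timelike.
    · refine ⟨he₀.contMDiffAt_radius hp₀, ofComponents e₀ p (Pi.single 1 1), ?_⟩
      rw [he₀.isTangent_iff hp₀, components_ofComponents he₀.mem hp₀]
      simp
    · have hv := components_ofComponents he₀.mem hp₀ (Pi.single 0 1)
      have hneg : G p (ofComponents e₀ p (Pi.single 0 1)) (ofComponents e₀ p (Pi.single 0 1)) < 0 := by
        rw [he₀.metric_apply hp₀, hv, Finset.sum_eq_single 0]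
        · rw [staticCoeff_zero]
          simpa using hfpos _ (he₀.mem_coordRange p hp₀).1
        · intro b _ hb
          simp [hb]
        · simp
      refine ⟨ofComponents e₀ p (Pi.single 0 1), ?_, fun h0 => ?_, hneg.le⟩
      · rw [he₀.isTangent_iff hp₀, hv]
        simp [h01]
      · rw [h0] at hneg
        simp at hneg
    · exact he₀.exists_null_geodesic hJ hJpos hf hg hfpos hgpos h hp₀ hp hk hnull

end Main

end PhotonSurface

end

theorem mainTheorem2 (n : ℕ) (κ : PhotonSurface.SpatialSymmetry)
    (J : Set ℝ) (hJ : IsOpen J) (hJpos : ∀ r ∈ J, 0 < r)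
    (f g : ℝ → ℝ) (hf : ContDiffOn ℝ 1 f J) (hg : ContDiffOn ℝ 1 g J)
    (hfpos : ∀ r ∈ J, 0 < f r) (hgpos : ∀ r ∈ J, 0 < g r)
    {M : Type*} [TopologicalSpace M] [ChartedSpace (PhotonSurface.Coord (n + 3)) M]
    [IsManifold 𝓘(ℝ, PhotonSurface.Coord (n + 3)) ∞ M]
    (G : PhotonSurface.BilinField (n + 3) M) (R : M → ℝ)
    (hM : PhotonSurface.IsStaticSpacetime κ J f g G R)
    (ρ : ℝ) (hρ : ∃ p : M, R p = ρ) :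
    (PhotonSurface.IsPhotonSurface G R ρ ↔ deriv (fun r => f r / r ^ 2) ρ = 0) ∧
      (PhotonSurface.IsTotallyUmbilic G R ρ ↔ deriv (fun r => f r / r ^ 2) ρ = 0) := by
  have hd : deriv (fun r => f r / r ^ 2) ρ = 0 ↔ deriv f ρ / f ρ = 2 / ρ := by
    obtain ⟨p, rfl⟩ := hρ
    obtain ⟨e, he, hp⟩ := hM.exists_isStaticChart p
    have hJp : R p ∈ J := he.radius p hp ▸ (he.mem_coordRange p hp).1
    exact PhotonSurface.deriv_div_sq_eq_zero_iff hJ hf hJp (hJpos _ hJp) (hfpos _ hJp)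
  rw [hd]
  exact ⟨PhotonSurface.isPhotonSurface_iff hJ hJpos hf hg hfpos hgpos hM hρ,
    PhotonSurface.isTotallyUmbilic_iff hJ hJpos hf hg hfpos hgpos hM hρ⟩
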